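/- **Conventions.** All spaces are compactly generated Hausdorff and products are formed in that category. In $S_n$ the product is $\sigma\tau:=\tau\circ\sigma$. A (topological) operad $\mathscr C$ consists of spaces $\mathscr C(n)$, $n\ge 0$, with $\mathscr C(0)$ a point, continuous associative compositions $\gamma:\mathscr C(k)\times\mathscr C(m_1)\times\cdots\times\mathscr C(m_k)\to\mathscr C(m_1+\cdots+m_k)$, and a two-sided unit $1\in\mathscr C(1)$. The groups $S_n$ form a (discrete) operad $\mathscr S$, where $\gamma(\sigma;\tau_1,\dots,\tau_k)$ permutes the $i$-th block by $\tau_i$ and moves it to position $\sigma(i)$. A *group operad* $\mathscr G$ is a discrete operad whose terms $G_n$ are groups, whose unit is the identity of $G_1$, with a morphism of operads $\pi:\mathscr G\to\mathscr S$ consisting of homomorphisms, such that $\gamma(aa';b_1b_1',\dots,b_kb_k')=\gamma(a;b_1,\dots,b_k)\,\gamma(a';b'_{a^{-1}(1)},\dots,b'_{a^{-1}(k)})$, where $a(i):=(\pi a)(i)$. A *$\mathscr G$-operad* is a topological operad $\mathscr C$ with left actions of $G_n$ on $\mathscr C(n)$ by homeomorphisms such that $\gamma(\sigma a;\tau_1b_1,\dots,\tau_kb_k)=\gamma(\sigma;\tau_1,\dots,\tau_k)\,\gamma(a;b_{\sigma^{-1}(1)},\dots,b_{\sigma^{-1}(k)})$;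 morphisms are levelwise continuous equivariant maps preserving $\gamma$ and $1$. It is a *covering* $\mathscr G$-operad if every point of every $\mathscr C(n)$ has a neighbourhood whose translates by distinct elements of $G_n$ are disjoint. Topological properties of $\mathscr C$ are meant for every $\mathscr C(n)$. Let $\mathscr C_1(k)$ be the space of $k$-tuples of nondegenerate closed subintervals of $[0,1]$ with pairwise disjoint interiors (the little intervals operad), let $c_k=([0,\frac1k],\dots,[\frac{k-1}k,1])$ and let $\mathscr C_1(k)_0$ be the path component of $c_k$; these form a nonsymmetric operad $(\mathscr C_1)_0$. A *good basepoint* of $\mathscr C$ is given by a morphism of nonsymmetric topological operads $\eta:(\mathscr C_1)_0\to\mathscr C$; put $e_k=\eta(c_k)$. The *linear path* $e_m\to\gamma(e_k;e_{m_1},\dots,e_{m_k})$, $m=m_1+\cdots+m_k$, is the image under $\eta$ of the linear path in $\mathscr C_1(m)_0$ from $c_m$ to $\gamma(c_k;c_{m_1},\dots,c_{m_k})$. **Theorem.** Let $\mathscr G$ be a group operad and $\mathscr C$ a path-connected, locally path-connected, semilocally simply-connected covering $\mathscr G$-operad with a good basepoint $\eta$. 1. For each $n$ let $\pi_1(\mathscr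 C(n);e_n,G_ne_n)$ be the set of pairs $(g,[f])$ with $g\in G_n$ and $[f]$ a homotopy class rel end points of paths from $e_n$ to $ge_n$, with product $(g,[f])(g',[f'])=(gg',[f\cdot gf'])$ and projection $\pi(g,[f])=g$. The quotient map $\mathscr C(n)\to\mathscr C(n)/G_n$ induces an isomorphism from this group to $\pi_1(\mathscr C(n)/G_n,G_ne_n)$ (with concatenation as product). These groups form a group operad $\pi_1(\mathscr C/\mathscr G)$, with structure maps to $S_n$ the composites of $\pi$ with $G_n\to S_n$, and with $\gamma((\sigma,[f]);(\tau_1,[g_1]),\dots,(\tau_k,[g_k]))$ equal to $\gamma(\sigma;\tau_1,\dots,\tau_k)$ together with the class of the concatenation of the linear path $e_m\to\gamma(e_k;e_{m_1},\dots,e_{m_k})$, the path $\gamma(f;g_1,\dots,g_k)$, and the translate by $\gamma(\sigma;\tau_1,\dots,\tau_k)$ of the reverse of the linear path $e_m\to\gamma(e_k;e_{m_{\sigma^{-1}(1)}},\dots,e_{m_{\sigma^{-1}(k)}})$. 2. Let $\widetilde{\mathscr C}(n)$ be the set of homotopy classes rel end points $[\alpha]$ of paths in $\mathscr C(n)$ starting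 at $e_n$, with its usual topology (generated by the sets $\{[\alpha\cdot\beta]:\beta \text{ a path in } U,\ \beta(0)=\alpha(1)\}$, $U$ open with $\alpha(1)\in U$), with projection $p[\alpha]=\alpha(1)$ and with action $(g,[f])\cdot[\alpha]=[f\cdot g\alpha]$ of $\pi_1(\mathscr C(n);e_n,G_ne_n)$. With unit the class of the constant path at $e_1$ and the composition $$\widetilde\gamma([\alpha];[\beta_1],\dots,[\beta_k])=[\,e_m\to\gamma(e_k;e_{m_1},\dots,e_{m_k})\xrightarrow{\gamma(\alpha;\beta_1,\dots,\beta_k)}\gamma(\alpha(1);\beta_1(1),\dots,\beta_k(1))\,],$$ whose first arrow is the linear path, $\widetilde{\mathscr C}$ is a covering $\pi_1(\mathscr C/\mathscr G)$-operad. Moreover $\widetilde\gamma$ is the unique continuous lifting of $\gamma\circ p$ through $p$ that takes $([e_k];[e_{m_1}],\dots,[e_{m_k}])$ to the class of the linear path $e_m\to\gamma(e_k;e_{m_1},\dots,e_{m_k})$. 3. $(\widetilde{\mathscr C},p)$ is a universal cover of $\mathscr C$: $\pi:\pi_1(\mathscr C/\mathscr G)\to\mathscr G$ is an epimorphism of group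 operads, $p$ is a morphism of $\pi_1(\mathscr C/\mathscr G)$-operads (where $\pi_1(\mathscr C/\mathscr G)$ acts on $\mathscr C$ through $\pi$), and each $p:\widetilde{\mathscr C}(n)\to\mathscr C(n)$ is a surjective covering map with simply connected total space. 4. Let $\pi_1\mathscr C(n)=\pi_1(\mathscr C(n),e_n)$ be the kernel of $\pi:\pi_1(\mathscr C(n);e_n,G_ne_n)\to G_n$. The structure of $\widetilde{\mathscr C}$ induces a $\mathscr G$-operad structure on the orbit spaces $\widetilde{\mathscr C}/\pi_1\mathscr C=\{\widetilde{\mathscr C}(n)/\pi_1\mathscr C(n)\}_{n\ge0}$ (the quotient maps preserve unit and composition and are equivariant along $\pi$), the projection $p$ factors through $\widetilde{\mathscr C}/\pi_1\mathscr C$, and the induced map $\widetilde{\mathscr C}/\pi_1\mathscr C\to\mathscr C$ is an isomorphism of $\mathscr G$-operads (equivariant, compatible with unit and composition, and a homeomorphism in each arity). -/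

import Mathlib

open scoped Topology

/-! ### Topological preliminaries -/

/-- Continuity on the compactly generated refinement (`k`-ification) of the domain.  For a map out
of a product of compactly generated Hausdorff spaces this is continuity for the product in the
category of compactly generated Hausdorff spaces. -/
def KContinuous {A B : Type*} [TopologicalSpace A] [TopologicalSpace B] (f : A → B) : Prop :=
  Continuous (f ∘ (CompactCoherentification.mk A).symm)

theorem KContinuous.comp_path {A B : Type*} [TopologicalSpace A] [TopologicalSpace B] {f : A → B}
    (hf : KContinuous f) {g : unitInterval → A} (hg : Continuous g) : Continuous (f ∘ g) := by
  have h : Continuous ((CompactCoherentification.mk A) ∘ g) :=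
    CompactCoherentification.continuous_rng_of_compactSpace.2 hg
  exact Continuous.comp (g := f ∘ (CompactCoherentification.mk A).symm) hf h

/-- Every point has a neighbourhood all of whose loops at that point are null-homotopic in the
whole space. -/
def SemilocallySimplyConnected (X : Type*) [TopologicalSpace X] : Prop :=
  ∀ x : X, ∃ U ∈ 𝓝 x, ∀ γ : Path x x, Set.range γ ⊆ U → γ.Homotopic (Path.refl x)

/-- A covering action of a discrete group (acting by homeomorphisms): every point has a
neighbourhood whose translates by distinct group elements are disjoint. -/
def IsCoveringAction (G X : Type*) [Group G] [TopologicalSpace X] [MulAction G X]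
    [ContinuousConstSMul G X] : Prop :=
  ∀ x : X, ∃ U ∈ 𝓝 x, ∀ g h : G,
    (((g • ·) '' U : Set X) ∩ ((h • ·) '' U)).Nonempty → g = h

namespace Path.Homotopic.Quotient

variable {X : Type*} [TopologicalSpace X]

theorem refl_cast {x y z : X} (h : y = x) (h' : z = x) :
    (refl x).cast h h' = (refl y).cast rfl (h'.trans h.symm) := by
  subst h; rfl

theorem trans_cast_right {x y z z' : X} (p : Path.Homotopic.Quotient x y)
    (q : Path.Homotopic.Quotient y z) (h : z' = z) :
    p.trans (q.cast rfl h) = (p.trans q).cast rfl h := by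
  subst h; simp

theorem cast_trans_cast {x x' y y' z z' : X} (p : Path.Homotopic.Quotient x y)
    (q : Path.Homotopic.Quotient y z) (hx : x' = x) (hy : y' = y) (hz : z' = z) :
    (p.cast hx hy).trans (q.cast hy hz) = (p.trans q).cast hx hz := by
  subst hx; subst hy; subst hz; simp

theorem map_trans {Y : Type*} [TopologicalSpace Y] {x y z : X} (p : Path.Homotopic.Quotient x y)
    (q : Path.Homotopic.Quotient y z) (f : C(X, Y)) :
    (p.trans q).map f = (p.map f).trans (q.map f) := by
  induction p with | mk p =>
  induction q with | mk q =>
  rw [← mk_trans, ← mk_map, Path.map_trans]; rfl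

variable {G : Type*} [Group G] [MulAction G X] [ContinuousConstSMul G X]

/-- Translate of a homotopy class of paths by a group element. -/
def translate {x y : X} (g : G) (p : Path.Homotopic.Quotient x y) :
    Path.Homotopic.Quotient (g • x) (g • y) :=
  p.map ⟨(g • ·), continuous_const_smul g⟩

theorem translate_trans {x y z : X} (g : G) (p : Path.Homotopic.Quotient x y)
    (q : Path.Homotopic.Quotient y z) :
    (p.trans q).translate g = (p.translate g).trans (q.translate g) := map_trans ..

theorem translate_cast {x y x' y' : X} (g : G) (p : Path.Homotopic.Quotient x y) (hx : x' = x)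
    (hy : y' = y) : (p.cast hx hy).translate g =
      (p.translate g).cast (by rw [hx]) (by rw [hy]) := by
  subst hx; subst hy; simp

theorem translate_mul {x y : X} (g h : G) (p : Path.Homotopic.Quotient x y) :
    p.translate (g * h) = ((p.translate h).translate g).cast (mul_smul ..) (mul_smul ..) := by
  induction p with | mk p =>
  refine congrArg mk ?_
  ext t
  exact mul_smul g h (p t)

theorem translate_one {x y : X} (p : Path.Homotopic.Quotient x y) :
    p.translate (1 : G) = p.cast (one_smul ..) (one_smul ..) := by
  induction p with | mk p =>
  refine congrArg mk ?_
  ext t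
  exact one_smul G (p t)

theorem translate_refl (g : G) (x : X) :
    (refl x).translate g = refl (g • x) := rfl

end Path.Homotopic.Quotient

/-! ### The universal cover of a pointed space -/

/-- Homotopy classes, relative to the end points, of paths starting at `e`. -/
def UnivCover (X : Type*) [TopologicalSpace X] (e : X) : Type _ :=
  Σ x : X, Path.Homotopic.Quotient e x

namespace UnivCover

variable {X : Type*} [TopologicalSpace X] {e : X}

/-- The class of a path. -/
def mk {x : X} (α : Path e x) : UnivCover X e := ⟨x, .mk α⟩

/-- The class of the constant path. -/
def base (e : X) : UnivCover X e := mk (Path.refl e)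

/-- The projection `[α] ↦ α(1)`. -/
def proj (a : UnivCover X e) : X := a.1

/-- The set `U_[α]` of classes `[α · η]` with `η` a path in `U` starting at `α(1)`. -/
def nhd (a : UnivCover X e) (U : Set X) : Set (UnivCover X e) :=
  {b | ∃ η : Path a.1 b.1, Set.range η ⊆ U ∧ b.2 = a.2.trans (.mk η)}

/-- The topology generated by the sets `U_[α]`, with `U` an open neighbourhood of `α(1)`. -/
instance : TopologicalSpace (UnivCover X e) :=
  TopologicalSpace.generateFrom {S | ∃ (a : UnivCover X e) (U : Set X),
    IsOpen U ∧ a.proj ∈ U ∧ S = a.nhd U}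

theorem ext {a b : UnivCover X e} (h : a.1 = b.1) (h' : a.2 = b.2.cast rfl h) : a = b := by
  obtain ⟨x, p⟩ := a
  obtain ⟨y, q⟩ := b
  dsimp only at h h'
  subst h
  rw [h', Path.Homotopic.Quotient.cast_rfl_rfl]

end UnivCover

/-! ### The fundamental group of an orbit space -/

/-- The set `π₁(X; e, Ge)`: pairs of a group element `g` and a homotopy class, relative to the end
points, of paths from `e` to `g • e`. -/
def OrbitPi1 (G X : Type*) [TopologicalSpace X] [Group G] [MulAction G X] (e : X) : Type _ :=
  Σ g : G, Path.Homotopic.Quotient e (g • e)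

namespace OrbitPi1

variable {G X : Type*} [TopologicalSpace X] [Group G] [MulAction G X] [ContinuousConstSMul G X]
  {e : X}

open Path.Homotopic.Quotient

/-- The class of a path from `e` to `g • e`. -/
def mk (g : G) (f : Path e (g • e)) : OrbitPi1 G X e := ⟨g, .mk f⟩

theorem ext {G X : Type*} [TopologicalSpace X] [Group G] [MulAction G X] {e : X}
    {a b : OrbitPi1 G X e} (h : a.1 = b.1)
    (h' : a.2 = b.2.cast rfl (by rw [h])) : a = b := by
  obtain ⟨x, p⟩ := a
  obtain ⟨y, q⟩ := b
  dsimp only at h h'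
  subst h
  rw [h', Path.Homotopic.Quotient.cast_rfl_rfl]

/-- The multiplication is `[f] * [f'] = [f · (g f')]` for `f` a path from `e` to `g • e`. -/
noncomputable instance : Group (OrbitPi1 G X e) where
  mul a b := ⟨a.1 * b.1, (a.2.trans (b.2.translate a.1)).cast rfl (mul_smul ..)⟩
  one := ⟨1, (Path.Homotopic.Quotient.refl e).cast rfl (one_smul ..)⟩
  inv a := ⟨a.1⁻¹, (a.2.symm.translate a.1⁻¹).cast (inv_smul_smul a.1 e).symm rfl⟩
  mul_assoc a b c := by
    refine ext (mul_assoc a.1 b.1 c.1) ?_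
    change (((a.2.trans (b.2.translate a.1)).cast rfl _).trans (c.2.translate (a.1 * b.1))).cast
      rfl _ = Path.Homotopic.Quotient.cast ((a.2.trans (Path.Homotopic.Quotient.translate a.1
        ((b.2.trans (c.2.translate b.1)).cast rfl _))).cast rfl _) _ _
    simp only [translate_cast, translate_trans, translate_mul, cast_trans_cast, trans_cast_right,
      trans_assoc, Path.Homotopic.Quotient.cast_cast]
  one_mul a := by
    refine ext (one_mul a.1) ?_
    change (((Path.Homotopic.Quotient.refl e).cast rfl _).trans (a.2.translate (1 : G))).cast rfl _ = _
    simp only [translate_one, cast_trans_cast, refl_trans, Path.Homotopic.Quotient.cast_cast]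
  mul_one a := by
    refine ext (mul_one a.1) ?_
    change (a.2.trans (Path.Homotopic.Quotient.translate a.1 ((Path.Homotopic.Quotient.refl e).cast rfl _))).cast rfl _ = _
    simp only [translate_cast, translate_refl, trans_cast_right, trans_refl, Path.Homotopic.Quotient.cast_cast]
  inv_mul_cancel a := by
    refine ext (inv_mul_cancel a.1) ?_
    change (((a.2.symm.translate a.1⁻¹).cast _ rfl).trans (a.2.translate a.1⁻¹)).cast rfl _ =
      Path.Homotopic.Quotient.cast ((Path.Homotopic.Quotient.refl e).cast rfl _) _ _
    have h := cast_trans_cast (a.2.symm.translate a.1⁻¹) (a.2.translate a.1⁻¹)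
      (inv_smul_smul a.1 e).symm rfl rfl
    rw [cast_rfl_rfl] at h
    rw [h, ← translate_trans, symm_trans, translate_refl, Path.Homotopic.Quotient.cast_cast, Path.Homotopic.Quotient.cast_cast]
    exact Path.Homotopic.Quotient.refl_cast _ _

/-- The homomorphism `π : π₁(X; e, Ge) → G`. -/
noncomputable def toGroup : OrbitPi1 G X e →* G where
  toFun a := a.1
  map_one' := rfl
  map_mul' _ _ := rfl

/-- The map `π₁(X; e, Ge) → π₁(X/G, Ge)` induced by the quotient map `X → X/G`; the target is the
set of homotopy classes of loops at the orbit of `e`. -/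
noncomputable def toLoop (a : OrbitPi1 G X e) :
    Path.Homotopic.Quotient (Quotient.mk (MulAction.orbitRel G X) e)
      (Quotient.mk (MulAction.orbitRel G X) e) :=
  (a.2.map ⟨Quotient.mk (MulAction.orbitRel G X), continuous_quotient_mk'⟩).cast rfl
    (Quotient.sound (MulAction.orbitRel_apply.2 (MulAction.mem_orbit_iff.2 ⟨a.1⁻¹, by simp⟩)))

/-- The action `[f] • [α] = [f · (g α)]` of `π₁(X; e, Ge)` on the universal cover, for `f` a path
from `e` to `g • e`. -/
noncomputable instance : MulAction (OrbitPi1 G X e) (UnivCover X e) where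
  smul a b := ⟨a.1 • b.1, a.2.trans (b.2.translate a.1)⟩
  one_smul b := by
    refine UnivCover.ext (one_smul G b.1) ?_
    change ((Path.Homotopic.Quotient.refl e).cast rfl _).trans (b.2.translate (1 : G)) = _
    simp only [translate_one, cast_trans_cast, refl_trans]
  mul_smul a b c := by
    refine UnivCover.ext (mul_smul a.1 b.1 c.1) ?_
    change ((a.2.trans (b.2.translate a.1)).cast rfl _).trans (c.2.translate (a.1 * b.1)) =
      (a.2.trans (Path.Homotopic.Quotient.translate a.1 (b.2.trans (c.2.translate b.1)))).cast rfl _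
    simp only [translate_trans, translate_mul, cast_trans_cast, trans_assoc]

theorem smul_mem_nhd (a : OrbitPi1 G X e) {b c : UnivCover X e} {U V : Set X}
    (hUV : ∀ x ∈ U, a.1 • x ∈ V) (h : c ∈ b.nhd U) : a • c ∈ (a • b).nhd V := by
  obtain ⟨η, hη, hc⟩ := h
  refine ⟨η.map (continuous_const_smul a.1), ?_, ?_⟩
  · rintro _ ⟨t, rfl⟩
    exact hUV _ (hη ⟨t, rfl⟩)
  · change a.2.trans (c.2.translate a.1) = (a.2.trans (b.2.translate a.1)).trans _
    rw [hc, translate_trans, trans_assoc]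
    rfl

instance : ContinuousConstSMul (OrbitPi1 G X e) (UnivCover X e) where
  continuous_const_smul a := by
    refine continuous_generateFrom_iff.2 ?_
    rintro _ ⟨b, U, hU, hb, rfl⟩
    refine TopologicalSpace.isOpen_generateFrom_of_mem
      ⟨a⁻¹ • b, (a.1 • ·) ⁻¹' U, hU.preimage (continuous_const_smul a.1), ?_, ?_⟩
    · change a.1 • a.1⁻¹ • b.proj ∈ U
      rwa [smul_inv_smul]
    · ext c
      constructor
      · intro h
        have := smul_mem_nhd a⁻¹ (V := (a.1 • ·) ⁻¹' U) (fun x hx ↦ by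
          change a.1 • a.1⁻¹ • x ∈ U
          rwa [smul_inv_smul]) h
        rwa [inv_smul_smul] at this
      · intro h
        have := smul_mem_nhd a (V := U) (fun x hx ↦ hx) h
        rwa [smul_inv_smul] at this

/-- The kernel of `π : π₁(X; e, Ge) → G`, that is, `π₁(X, e)`. -/
noncomputable abbrev pi1 (G X : Type*) [TopologicalSpace X] [Group G] [MulAction G X]
    [ContinuousConstSMul G X] (e : X) : Subgroup (OrbitPi1 G X e) :=
  (toGroup : OrbitPi1 G X e →* G).ker

end OrbitPi1

/-- The orbit space of the universal cover of `(X, e)` under `π₁(X, e)`. -/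
abbrev UnivCover.ModPi1 (G X : Type*) [TopologicalSpace X] [Group G] [MulAction G X]
    [ContinuousConstSMul G X] (e : X) : Type _ :=
  MulAction.orbitRel.Quotient (OrbitPi1.pi1 G X e) (UnivCover X e)

/-! ### Operads -/

/-- Positions in a concatenation of `k` blocks of lengths `m 0, …, m (k - 1)`, in the
lexicographic order. -/
def blockEquiv {k n : ℕ} (m : Fin k → ℕ) (h : ∑ i, m i = n) : (Σ i, Fin (m i)) ≃ Fin n :=
  finSigmaFinEquiv.trans (finCongr h)

theorem sum_perm {k n : ℕ} {m : Fin k → ℕ} (h : ∑ i, m i = n) (s : Equiv.Perm (Fin k)) :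
    ∑ i, m (s.symm i) = n :=
  (Equiv.sum_comp s.symm m).trans h

/-- An operad of sets with a single operation of arity zero: `comp` is the composition
`γ(a; b₁, …, b_k)`, with target indexed by any `n` equal to `m₁ + ⋯ + m_k`. -/
structure Operad (X : ℕ → Type*) where
  one : X 1
  comp : ∀ {k n : ℕ} (m : Fin k → ℕ) (_ : ∑ i, m i = n), X k → (∀ i, X (m i)) → X n
  unique_zero : Nonempty (Unique (X 0))
  assoc : ∀ {k N n : ℕ} (m : Fin k → ℕ) (h : ∑ i, m i = N) (l : Fin N → ℕ) (h₁ : ∑ j, l j = n)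
    (h₂ : ∑ i, ∑ x, l (blockEquiv m h ⟨i, x⟩) = n) (a : X k) (b : ∀ i, X (m i))
    (c : ∀ j, X (l j)),
    comp l h₁ (comp m h a b) c =
      comp (fun i ↦ ∑ x, l (blockEquiv m h ⟨i, x⟩)) h₂ a
        (fun i ↦ comp (fun x ↦ l (blockEquiv m h ⟨i, x⟩)) rfl (b i)
          (fun x ↦ c (blockEquiv m h ⟨i, x⟩)))
  one_comp : ∀ {n : ℕ} (a : X n), comp (fun _ : Fin 1 ↦ n) (by simp) one (fun _ ↦ a) = a
  comp_one : ∀ {n : ℕ} (a : X n), comp (fun _ : Fin n ↦ 1) (by simp) a (fun _ ↦ one) = a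

/-- A topological operad: an operad in compactly generated Hausdorff spaces. -/
structure TopOperad (X : ℕ → Type*) [∀ n, TopologicalSpace (X n)] extends Operad X where
  t2 : ∀ n, T2Space (X n)
  compactlyGenerated : ∀ n, CompactlyCoherentSpace (X n)
  continuous_comp : ∀ {k n : ℕ} (m : Fin k → ℕ) (h : ∑ i, m i = n),
    KContinuous fun p : X k × (∀ i, X (m i)) ↦ comp m h p.1 p.2

/-- The path `t ↦ γ(α(t); β₁(t), …, β_k(t))`. -/
def TopOperad.compPath {X : ℕ → Type*} [∀ n, TopologicalSpace (X n)] (C : TopOperad X) {k n : ℕ}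
    (m : Fin k → ℕ) (h : ∑ i, m i = n) {a a' : X k} {b b' : ∀ i, X (m i)} (α : Path a a')
    (β : ∀ i, Path (b i) (b' i)) : Path (C.comp m h a b) (C.comp m h a' b') where
  toFun t := C.comp m h (α t) (fun i ↦ β i t)
  continuous_toFun := (C.continuous_comp m h).comp_path (g := fun t ↦ (α t, fun i ↦ β i t))
    (α.continuous.prodMk (continuous_pi fun i ↦ (β i).continuous))
  source' := by simp
  target' := by simp

/-- Composition in the operad of symmetric groups: `τ i` permutes the `i`-th block, which is then
moved to the position `σ i`. -/
def symComp {k n : ℕ} (m : Fin k → ℕ) (h : ∑ i, m i = n) (σ : Equiv.Perm (Fin k))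
    (τ : ∀ i, Equiv.Perm (Fin (m i))) : Equiv.Perm (Fin n) :=
  (blockEquiv m h).symm.trans
    ((Equiv.sigmaCongr σ (β₂ := fun j ↦ Fin (m (σ.symm j)))
      (fun i ↦ (τ i).trans (finCongr (by simp)))).trans
        (blockEquiv (fun j ↦ m (σ.symm j)) (sum_perm h σ)))

/-- A group operad.  The structure map `π` to the symmetric groups is `perm`; as in `perm_mul`, a
product in the symmetric groups acts by its left factor first. -/
structure GroupOperad (G : ℕ → Type*) [∀ n, Group (G n)] extends Operad G where
  perm : ∀ {n : ℕ}, G n → Equiv.Perm (Fin n)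
  perm_mul : ∀ {n : ℕ} (a b : G n), perm (a * b) = (perm a).trans (perm b)
  perm_comp : ∀ {k n : ℕ} (m : Fin k → ℕ) (h : ∑ i, m i = n) (a : G k) (b : ∀ i, G (m i)),
    perm (comp m h a b) = symComp m h (perm a) (fun i ↦ perm (b i))
  one_eq : one = 1
  comp_mul : ∀ {k n : ℕ} (m : Fin k → ℕ) (h : ∑ i, m i = n) (a a' : G k) (b b' : ∀ i, G (m i)),
    comp m h (a * a') (fun i ↦ b i * b' i) =
      comp m h a b * comp (fun i ↦ m ((perm a).symm i)) (sum_perm h (perm a)) a'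
        (fun i ↦ b' ((perm a).symm i))

/-- A morphism of group operads. -/
structure GroupOperad.IsHom {G' G : ℕ → Type*} [∀ n, Group (G' n)] [∀ n, Group (G n)]
    (𝒢' : GroupOperad G') (𝒢 : GroupOperad G) (φ : ∀ n, G' n →* G n) : Prop where
  perm : ∀ {n : ℕ} (a : G' n), 𝒢.perm (φ n a) = 𝒢'.perm a
  comp : ∀ {k n : ℕ} (m : Fin k → ℕ) (h : ∑ i, m i = n) (a : G' k) (b : ∀ i, G' (m i)),
    φ n (𝒢'.comp m h a b) = 𝒢.comp m h (φ k a) (fun i ↦ φ (m i) (b i))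

/-- A topological `𝒢`-operad: the groups `G n` act from the left by homeomorphisms, and the
composition is equivariant. -/
structure GOperad {G : ℕ → Type*} [∀ n, Group (G n)] (𝒢 : GroupOperad G) (X : ℕ → Type*)
    [∀ n, TopologicalSpace (X n)] [∀ n, MulAction (G n) (X n)]
    [∀ n, ContinuousConstSMul (G n) (X n)] extends TopOperad X where
  smul_comp_smul : ∀ {k n : ℕ} (m : Fin k → ℕ) (h : ∑ i, m i = n) (σ : G k) (τ : ∀ i, G (m i))
    (a : X k) (b : ∀ i, X (m i)),
    comp m h (σ • a) (fun i ↦ τ i • b i) =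
      𝒢.comp m h σ τ • comp (fun i ↦ m ((𝒢.perm σ).symm i)) (sum_perm h (𝒢.perm σ)) a
        (fun i ↦ b ((𝒢.perm σ).symm i))

namespace GOperad

variable {G' G : ℕ → Type*} [∀ n, Group (G' n)] [∀ n, Group (G n)] {𝒢' : GroupOperad G'}
  {𝒢 : GroupOperad G} {X' X : ℕ → Type*} [∀ n, TopologicalSpace (X' n)]
  [∀ n, TopologicalSpace (X n)] [∀ n, MulAction (G' n) (X' n)] [∀ n, MulAction (G n) (X n)]
  [∀ n, ContinuousConstSMul (G' n) (X' n)] [∀ n, ContinuousConstSMul (G n) (X n)]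

/-- A covering `𝒢`-operad. -/
def IsCovering (_ : GOperad 𝒢 X) : Prop :=
  ∀ n, IsCoveringAction (G n) (X n)

/-- `ψ` is a morphism of `𝒢'`-operads from `C'` to `C`, the `𝒢`-operad `C` being regarded as a
`𝒢'`-operad via `φ : 𝒢' → 𝒢`. -/
structure IsHomAlong (φ : ∀ n, G' n →* G n) (C' : GOperad 𝒢' X') (C : GOperad 𝒢 X)
    (ψ : ∀ n, X' n → X n) : Prop where
  continuous : ∀ n, Continuous (ψ n)
  map_smul : ∀ {n : ℕ} (g : G' n) (a : X' n), ψ n (g • a) = φ n g • ψ n a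
  map_one : ψ 1 C'.one = C.one
  map_comp : ∀ {k n : ℕ} (m : Fin k → ℕ) (h : ∑ i, m i = n) (a : X' k) (b : ∀ i, X' (m i)),
    ψ n (C'.comp m h a b) = C.comp m h (ψ k a) (fun i ↦ ψ (m i) (b i))

/-- An isomorphism of `𝒢`-operads. -/
def IsIso (C' : GOperad 𝒢 X) {Y : ℕ → Type*} [∀ n, TopologicalSpace (Y n)]
    [∀ n, MulAction (G n) (Y n)] [∀ n, ContinuousConstSMul (G n) (Y n)] (C : GOperad 𝒢 Y)
    (ψ : ∀ n, X n → Y n) : Prop :=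
  IsHomAlong (fun n ↦ MonoidHom.id (G n)) C' C ψ ∧ ∀ n, IsHomeomorph (ψ n)

/-- `(C', ψ)` is a universal cover of the `𝒢`-operad `C`: `φ : 𝒢' → 𝒢` is an epimorphism of group
operads, `ψ` is a morphism of `𝒢'`-operads, and `ψ` is a universal covering in each arity. -/
structure IsUniversalCover (φ : ∀ n, G' n →* G n) (C' : GOperad 𝒢' X') (C : GOperad 𝒢 X)
    (ψ : ∀ n, X' n → X n) : Prop where
  isHom_group : GroupOperad.IsHom 𝒢' 𝒢 φ
  surjective_group : ∀ n, Function.Surjective (φ n)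
  isHom : IsHomAlong φ C' C ψ
  isCoveringMap : ∀ n, IsCoveringMap (ψ n)
  surjective : ∀ n, Function.Surjective (ψ n)
  simplyConnected : ∀ n, SimplyConnectedSpace (X' n)

end GOperad

/-! ### Little intervals and good basepoints -/

/-- The space of `k`-tuples of nondegenerate closed subintervals of `[0, 1]` with pairwise disjoint
interiors, an interval being given by its pair of end points. -/
abbrev LittleIntervals (k : ℕ) : Type :=
  {c : Fin k → ℝ × ℝ // (∀ i, 0 ≤ (c i).1 ∧ (c i).1 < (c i).2 ∧ (c i).2 ≤ 1) ∧
    ∀ i j, i ≠ j → Disjoint (Set.Ioo (c i).1 (c i).2) (Set.Ioo (c j).1 (c j).2)}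

namespace LittleIntervals

/-- The intervals are arranged from left to right. -/
def Ordered {k : ℕ} (c : Fin k → ℝ × ℝ) : Prop :=
  (∀ i, 0 ≤ (c i).1 ∧ (c i).1 < (c i).2 ∧ (c i).2 ≤ 1) ∧ ∀ i j, i < j → (c i).2 ≤ (c j).1

theorem Ordered.disjoint {k : ℕ} {c : Fin k → ℝ × ℝ} (hc : Ordered c) (i j : Fin k) (h : i ≠ j) :
    Disjoint (Set.Ioo (c i).1 (c i).2) (Set.Ioo (c j).1 (c j).2) := by
  rw [Set.disjoint_left]
  intro x hx hx'
  rcases lt_or_gt_of_ne h with h | h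
  · linarith [hc.2 i j h, hx.2, hx'.1]
  · linarith [hc.2 j i h, hx.1, hx'.2]

/-- A tuple of intervals arranged from left to right. -/
def ofOrdered {k : ℕ} {c : Fin k → ℝ × ℝ} (hc : Ordered c) : LittleIntervals k :=
  ⟨c, hc.1, hc.disjoint⟩

theorem ordered_std (k : ℕ) : Ordered fun i : Fin k ↦ ((i : ℝ) / k, ((i : ℝ) + 1) / k) := by
  refine ⟨fun i ↦ ?_, fun i j h ↦ ?_⟩
  · have hk : (0 : ℝ) < k := by exact_mod_cast i.pos
    have hi : (i : ℝ) + 1 ≤ k := by exact_mod_cast i.2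
    refine ⟨by positivity, ?_, ?_⟩
    · exact div_lt_div_of_pos_right (by linarith) hk
    · exact (div_le_one hk).2 hi
  · have hi : (i : ℝ) + 1 ≤ j := by exact_mod_cast h
    exact div_le_div_of_nonneg_right hi (by positivity)

/-- The configuration `c_k = ([0, 1/k], [1/k, 2/k], …, [(k-1)/k, 1])`. -/
noncomputable def std (k : ℕ) : LittleIntervals k := ofOrdered (ordered_std k)

theorem ordered_combo {k : ℕ} {c c' : Fin k → ℝ × ℝ} (hc : Ordered c) (hc' : Ordered c') (t : unitInterval) :
    Ordered ((1 - (t : ℝ)) • c + (t : ℝ) • c') := by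
  have ht := t.2.1
  have ht' : (0 : ℝ) ≤ 1 - t := by linarith [t.2.2]
  refine ⟨fun i ↦ ?_, fun i j h ↦ ?_⟩
  · obtain ⟨h1, h2, h3⟩ := hc.1 i
    obtain ⟨h1', h2', h3'⟩ := hc'.1 i
    simp only [Pi.add_apply, Pi.smul_apply, Prod.fst_add, Prod.snd_add, Prod.smul_fst,
      Prod.smul_snd, smul_eq_mul]
    refine ⟨by positivity, ?_, by nlinarith⟩
    rcases eq_or_lt_of_le ht with h | h
    · rw [← h]; linarith
    · nlinarith
  · have := hc.2 i j h
    have := hc'.2 i j h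
    simp only [Pi.add_apply, Pi.smul_apply, Prod.fst_add, Prod.snd_add, Prod.smul_fst,
      Prod.smul_snd, smul_eq_mul]
    nlinarith

/-- The linear path between two configurations arranged from left to right. -/
def linearPathOfOrdered {k : ℕ} (c c' : LittleIntervals k) (hc : Ordered c.1)
    (hc' : Ordered c'.1) : Path c c' where
  toFun t := ofOrdered (ordered_combo hc hc' t)
  continuous_toFun := by
    refine Continuous.subtype_mk ?_ _
    fun_prop
  source' := Subtype.ext (by simp [ofOrdered])
  target' := Subtype.ext (by simp [ofOrdered])

/-- The path component of `c_k` consists of the configurations arranged from left to right. -/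
theorem mem_pathComponent_std {k : ℕ} (c : LittleIntervals k) :
    c ∈ pathComponent (std k) ↔ Ordered c.1 := by
  refine ⟨fun ⟨p⟩ ↦ ⟨c.2.1, fun i j hij ↦ ?_⟩, fun h ↦
    ⟨linearPathOfOrdered _ _ (ordered_std k) h⟩⟩
  have key : ∀ d : LittleIntervals k, (d.1 i).1 ≠ (d.1 j).1 := by
    intro d hd
    have hi := (d.2.1 i).2.1
    have hj := (d.2.1 j).2.1
    obtain ⟨x, hx, hx'⟩ := exists_between (lt_min hi (hd ▸ hj))
    exact Set.disjoint_left.1 (d.2.2 i j hij.ne) ⟨hx, hx'.trans_le (min_le_left _ _)⟩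
      ⟨hd ▸ hx, hx'.trans_le (min_le_right _ _)⟩
  have hlt : (c.1 i).1 < (c.1 j).1 := by
    by_contra hcon
    have hcont : Continuous fun t : unitInterval ↦ ((p t).1 j).1 - ((p t).1 i).1 :=
      ((continuous_apply j).comp (continuous_subtype_val.comp p.continuous)).fst.sub
        ((continuous_apply i).comp (continuous_subtype_val.comp p.continuous)).fst
    have h0 : 0 ≤ ((p 0).1 j).1 - ((p 0).1 i).1 := by
      have := (ordered_std k).2 i j hij
      have := ((ordered_std k).1 i).2.1
      rw [p.source]
      simp only [std, ofOrdered]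
      linarith
    have h1 : ((p 1).1 j).1 - ((p 1).1 i).1 ≤ 0 := by
      rw [p.target]; linarith
    obtain ⟨t, ht⟩ := mem_range_of_exists_le_of_exists_ge hcont ⟨1, h1⟩ ⟨0, h0⟩
    exact key (p t) (by linarith)
  by_contra hcon
  push Not at hcon
  obtain ⟨x, hx, hx'⟩ := exists_between (lt_min hcon (c.2.1 j).2.1)
  exact Set.disjoint_left.1 (c.2.2 i j hij.ne)
    ⟨hlt.trans hx, hx'.trans_le (min_le_left _ _)⟩ ⟨hx, hx'.trans_le (min_le_right _ _)⟩

end LittleIntervals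

/-- The path component of `c_k` in the space of `k`-tuples of little intervals. -/
abbrev LittleIntervals₀ (k : ℕ) : Type :=
  {c : LittleIntervals k // c ∈ pathComponent (LittleIntervals.std k)}

namespace LittleIntervals₀

open LittleIntervals

/-- The element `c_k`. -/
noncomputable def std (k : ℕ) : LittleIntervals₀ k :=
  ⟨LittleIntervals.std k, mem_pathComponent_self _⟩

theorem ordered {k : ℕ} (c : LittleIntervals₀ k) : Ordered c.1.1 :=
  (mem_pathComponent_std c.1).1 c.2

/-- A tuple of intervals arranged from left to right, as a point of the path component. -/
def ofOrdered {k : ℕ} {c : Fin k → ℝ × ℝ} (hc : Ordered c) : LittleIntervals₀ k :=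
  ⟨LittleIntervals.ofOrdered hc, (mem_pathComponent_std _).2 hc⟩

/-- The linear path `t ↦ (1 - t) c + t c'`. -/
def linearPath {k : ℕ} (c c' : LittleIntervals₀ k) : Path c c' where
  toFun t := ofOrdered (ordered_combo c.ordered c'.ordered t)
  continuous_toFun := by
    refine Continuous.subtype_mk (Continuous.subtype_mk ?_ _) _
    fun_prop
  source' := Subtype.ext (Subtype.ext (by simp [ofOrdered, LittleIntervals.ofOrdered]))
  target' := Subtype.ext (Subtype.ext (by simp [ofOrdered, LittleIntervals.ofOrdered]))

/-- The images of the intervals `b i x` under the increasing affine maps from `[0, 1]` onto the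
intervals `a i`, in the lexicographic order. -/
def compFun {k n : ℕ} (m : Fin k → ℕ) (h : ∑ i, m i = n) (a : Fin k → ℝ × ℝ)
    (b : ∀ i, Fin (m i) → ℝ × ℝ) (j : Fin n) : ℝ × ℝ :=
  let p := (blockEquiv m h).symm j
  ((a p.1).1 + ((a p.1).2 - (a p.1).1) * (b p.1 p.2).1,
    (a p.1).1 + ((a p.1).2 - (a p.1).1) * (b p.1 p.2).2)

theorem lex_of_lt {k n : ℕ} (m : Fin k → ℕ) (h : ∑ i, m i = n) (p q : Σ i, Fin (m i))
    (hpq : blockEquiv m h p < blockEquiv m h q) :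
    p.1 < q.1 ∨ ∃ e : p.1 = q.1, Fin.cast (congrArg m e) p.2 < q.2 := by
  have hval : ∀ r : Σ i, Fin (m i), (blockEquiv m h r : ℕ) =
      ∑ i ∈ Finset.univ.filter (· < r.1), m i + r.2 := by
    intro r
    change (finSigmaFinEquiv r : ℕ) = _
    rw [finSigmaFinEquiv_apply]
    congr 1
    refine Finset.sum_bij (fun i _ ↦ Fin.castLE r.1.2.le i) ?_ ?_ ?_ ?_
    · intro i _
      exact Finset.mem_filter.2 ⟨Finset.mem_univ _, i.2⟩
    · intro i _ i' _ e
      exact Fin.castLE_injective _ e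
    · intro i hi
      exact ⟨⟨i, (Finset.mem_filter.1 hi).2⟩, Finset.mem_univ _, rfl⟩
    · intro i _
      rfl
  rw [Fin.lt_def, hval, hval] at hpq
  rcases lt_trichotomy p.1 q.1 with hlt | heq | hgt
  · exact Or.inl hlt
  · refine Or.inr ⟨heq, ?_⟩
    have hS : ∑ i ∈ Finset.univ.filter (· < p.1), m i =
        ∑ i ∈ Finset.univ.filter (· < q.1), m i := by rw [heq]
    rw [Fin.lt_def, Fin.val_cast]
    omega
  · exfalso
    have hsub : insert q.1 (Finset.univ.filter (· < q.1)) ⊆ Finset.univ.filter (· < p.1) := by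
      intro i hi
      rcases Finset.mem_insert.1 hi with rfl | hi
      · simpa using hgt
      · have := (Finset.mem_filter.1 hi).2
        simpa using this.trans hgt
    have hle := Finset.sum_le_sum_of_subset (f := m) hsub
    rw [Finset.sum_insert (by simp)] at hle
    have := q.2.2
    omega

theorem ordered_comp {k n : ℕ} (m : Fin k → ℕ) (h : ∑ i, m i = n) {a : Fin k → ℝ × ℝ}
    {b : ∀ i, Fin (m i) → ℝ × ℝ} (ha : Ordered a) (hb : ∀ i, Ordered (b i)) :
    Ordered (compFun m h a b) := by
  refine ⟨fun j ↦ ?_, fun j j' hj ↦ ?_⟩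
  · simp only [compFun]
    generalize (blockEquiv m h).symm j = p
    obtain ⟨h1, h2, h3⟩ := ha.1 p.1
    obtain ⟨h1', h2', h3'⟩ := (hb p.1).1 p.2
    exact ⟨by nlinarith, by nlinarith, by nlinarith⟩
  · have hlex := lex_of_lt m h ((blockEquiv m h).symm j) ((blockEquiv m h).symm j') (by simpa)
    simp only [compFun]
    generalize (blockEquiv m h).symm j = p at *
    generalize (blockEquiv m h).symm j' = q at *
    obtain ⟨h1, h2, h3⟩ := ha.1 p.1
    obtain ⟨h1', h2', h3'⟩ := (hb p.1).1 p.2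
    obtain ⟨k1, k2, k3⟩ := ha.1 q.1
    obtain ⟨k1', k2', k3'⟩ := (hb q.1).1 q.2
    rcases hlex with hlt | ⟨e, hlt⟩
    · have := ha.2 _ _ hlt
      nlinarith
    · obtain ⟨i, x⟩ := p
      obtain ⟨i', y⟩ := q
      dsimp only at e hlt
      subst e
      have := (hb i).2 x y hlt
      dsimp only at *
      nlinarith

/-- The composition of the nonsymmetric operad of path components of the `c_k`. -/
def comp {k n : ℕ} (m : Fin k → ℕ) (h : ∑ i, m i = n) (a : LittleIntervals₀ k)
    (b : ∀ i, LittleIntervals₀ (m i)) : LittleIntervals₀ n :=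
  ofOrdered (ordered_comp m h a.ordered fun i ↦ (b i).ordered)

end LittleIntervals₀

/-- A good basepoint of a topological operad: a morphism `η` of nonsymmetric topological operads
from the path components of the configurations `c_k`, whose unit is `c_1 = [0, 1]`. -/
structure GoodBasepoint {X : ℕ → Type*} [∀ n, TopologicalSpace (X n)] (C : TopOperad X) where
  η : ∀ n, LittleIntervals₀ n → X n
  continuous : ∀ n, Continuous (η n)
  map_one : η 1 (LittleIntervals₀.std 1) = C.one
  map_comp : ∀ {k n : ℕ} (m : Fin k → ℕ) (h : ∑ i, m i = n) (a : LittleIntervals₀ k)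
    (b : ∀ i, LittleIntervals₀ (m i)),
    η n (LittleIntervals₀.comp m h a b) = C.comp m h (η k a) (fun i ↦ η (m i) (b i))

namespace GoodBasepoint

variable {X : ℕ → Type*} [∀ n, TopologicalSpace (X n)] {C : TopOperad X}

/-- The basepoint `e_n = η(c_n)`. -/
noncomputable def pt (η : GoodBasepoint C) (n : ℕ) : X n := η.η n (LittleIntervals₀.std n)

/-- The linear path from `e_n` to `γ(e_k; e_{m₁}, …, e_{m_k})`. -/
noncomputable def linear (η : GoodBasepoint C) {k n : ℕ} (m : Fin k → ℕ) (h : ∑ i, m i = n) :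
    Path (η.pt n) (C.comp m h (η.pt k) (fun i ↦ η.pt (m i))) :=
  ((LittleIntervals₀.linearPath (LittleIntervals₀.std n) (LittleIntervals₀.comp m h
    (LittleIntervals₀.std k) (fun i ↦ LittleIntervals₀.std (m i)))).map (η.continuous n)).cast rfl
      (η.map_comp m h _ _).symm

end GoodBasepoint

/-! ### The fundamental groups operad and the universal cover of an operad -/

section Main

variable {G : ℕ → Type*} [∀ n, Group (G n)] {𝒢 : GroupOperad G} {X : ℕ → Type*}
  [∀ n, TopologicalSpace (X n)] [∀ n, MulAction (G n) (X n)]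
  [∀ n, ContinuousConstSMul (G n) (X n)]

/-- The path representing `γ([f]; [g₁], …, [g_k])`, for `f` a path from `e_k` to `σ e_k` and `g_i`
a path from `e_{m_i}` to `τ_i e_{m_i}`: the concatenation of the linear path
`e_n → γ(e_k; e_{m₁}, …)`, the path `γ(f; g₁, …)`, which ends at
`γ(σ; τ₁, …) γ(e_k; e_{m_{σ⁻¹(1)}}, …)`, and the translate by `γ(σ; τ₁, …)` of the reverse of the
linear path `e_n → γ(e_k; e_{m_{σ⁻¹(1)}}, …)`. -/
noncomputable def GOperad.pi1Path (C : GOperad 𝒢 X) (η : GoodBasepoint C.toTopOperad) {k n : ℕ}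
    (m : Fin k → ℕ) (h : ∑ i, m i = n) {s : G k} {t : ∀ i, G (m i)}
    (f : Path (η.pt k) (s • η.pt k)) (g : ∀ i, Path (η.pt (m i)) (t i • η.pt (m i))) :
    Path (η.pt n) (𝒢.comp m h s t • η.pt n) :=
  ((η.linear m h).trans
    ((C.compPath m h f g).cast rfl (C.smul_comp_smul m h s t _ _).symm)).trans
      ((η.linear (fun i ↦ m ((𝒢.perm s).symm i)) (sum_perm h (𝒢.perm s))).symm.map
        (continuous_const_smul (𝒢.comp m h s t)))

/-- `P` is the fundamental groups operad `π₁(C/𝒢)`, whose groups are `π₁(C(n); e_n, G_n e_n)`. -/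
structure GOperad.IsFundamentalGroupOperad (C : GOperad 𝒢 X) (η : GoodBasepoint C.toTopOperad)
    (P : GroupOperad fun n ↦ OrbitPi1 (G n) (X n) (η.pt n)) : Prop where
  perm : ∀ {n : ℕ} (f : OrbitPi1 (G n) (X n) (η.pt n)), P.perm f = 𝒢.perm f.toGroup
  comp : ∀ {k n : ℕ} (m : Fin k → ℕ) (h : ∑ i, m i = n) (s : G k) (t : ∀ i, G (m i))
    (f : Path (η.pt k) (s • η.pt k)) (g : ∀ i, Path (η.pt (m i)) (t i • η.pt (m i))),
    P.comp m h (.mk s f) (fun i ↦ .mk (t i) (g i)) = .mk (𝒢.comp m h s t) (C.pi1Path η m h f g)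

/-- `U` is the operad of the universal covers of the pointed spaces `(C(n), e_n)`, with composition
`γ̃([α]; [β₁], …, [β_k]) = [e_n → γ(e_k; e_{m₁}, …) → γ(α(1); β₁(1), …)]`, where the two paths are
the linear one and `γ(α; β₁, …)`. -/
structure GOperad.IsUnivCoverOperad (C : GOperad 𝒢 X) (η : GoodBasepoint C.toTopOperad)
    {P : GroupOperad fun n ↦ OrbitPi1 (G n) (X n) (η.pt n)}
    (U : GOperad P fun n ↦ UnivCover (X n) (η.pt n)) : Prop where
  one : U.one = .base (η.pt 1)
  comp : ∀ {k n : ℕ} (m : Fin k → ℕ) (h : ∑ i, m i = n) {x : X k} {y : ∀ i, X (m i)}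
    (α : Path (η.pt k) x) (β : ∀ i, Path (η.pt (m i)) (y i)),
    U.comp m h (.mk α) (fun i ↦ .mk (β i)) = .mk ((η.linear m h).trans (C.compPath m h α β))

/-- `f` is a lifting of `γ ∘ p` through `p`, continuous on the product of compactly generated
spaces, with value the class of the linear path `e_n → γ(e_k; e_{m₁}, …)` at the basepoint. -/
structure GOperad.IsLift (C : GOperad 𝒢 X) (η : GoodBasepoint C.toTopOperad) {k n : ℕ}
    (m : Fin k → ℕ) (h : ∑ i, m i = n)
    (f : UnivCover (X k) (η.pt k) → (∀ i, UnivCover (X (m i)) (η.pt (m i))) →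
      UnivCover (X n) (η.pt n)) : Prop where
  continuous : KContinuous fun p : UnivCover (X k) (η.pt k) ×
    (∀ i, UnivCover (X (m i)) (η.pt (m i))) ↦ f p.1 p.2
  proj : ∀ a b, (f a b).proj = C.comp m h a.proj (fun i ↦ (b i).proj)
  base : f (.base _) (fun _ ↦ .base _) = .mk (η.linear m h)

end Main

/-! The hypotheses on `C(n)` make `p` a covering with simply connected total space, and in fact the
quotient map for the free action of `π₁(C(n), e_n)`. The larger group `π₁(C(n); e_n, G_n e_n)`
consists of the lifts to the cover of the translations by `G_n`: if `w` lies over `g • p(z)`,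
exactly one element over `g` takes `z` to `w` (`OrbitPi1.exists_smul_eq`, `OrbitPi1.eq_of_smul_eq`).

The operad structure is then obtained by lifting. The composition of `C`, precomposed with the
projections, lifts to the universal covers (`GOperad.exists_isLift`), because the compactly
generated product of these covers is simply connected and locally path-connected. The latter is the
delicate topological point (`locallyPathConnectedSpace_compactCoherentification_prod`). An identity
between composites of liftings holds once it holds after projection and at basepoints, since a
lifted path is determined by its start (`UnivCover.eq_of_path`). After projection it is an axiom of
`C`. At basepoints it concerns classes of paths that come from `η`: ordered configurations of
intervals form a convex set, so `η` itself lifts, compatibly with compositions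
(`GOperad.IsLift.apply_lift`), and the identity reduces to one for little intervals.

The composition of the groups is not defined by its path formula but as the unique element that
makes the lifted composition equivariant at basepoints (`GOperad.exists_pi1Comp`). Equivariance
everywhere follows by lifting, and the axioms of a group operad follow by evaluation at a single
point (`GOperad.eq_pi1Comp_of_smul_eq`). Both path formulas are recovered by computing end points of
lifted paths (`GOperad.IsLift.apply_mk`, `OrbitPi1.mk_trans_smul_mk`).

Finally, `p` identifies the orbit spaces under `π₁(C(n), e_n)` with `C(n)`, and the quotient operad
carries the structure transported from `C`. -/

/-! ### Compact coherentifications -/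

section CompactCoherentification

open CompactCoherentification

variable {A B Y Z : Type*} [TopologicalSpace A] [TopologicalSpace B] [TopologicalSpace Y]
  [TopologicalSpace Z]

/-- This pointwise form allows a test compact set to be enlarged to a box or shrunk around the
point. -/
theorem CompactCoherentification.isOpen_iff_nhdsWithin {S : Set (CompactCoherentification Y)} :
    IsOpen S ↔ ∀ K : Set Y, IsCompact K → ∀ y ∈ K, y ∈ CompactCoherentification.mk Y ⁻¹' S →
      CompactCoherentification.mk Y ⁻¹' S ∈ 𝓝[K] y := by
  rw [CompactCoherentification.isOpen_iff]
  refine forall₂_congr fun K _ ↦ ?_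
  rw [isOpen_iff_mem_nhds]
  constructor
  · intro h y hy hyS
    exact mem_nhdsWithin_iff_exists_mem_nhds_inter.2 <| by
      obtain ⟨u, hu, hu'⟩ := mem_nhds_subtype K ⟨y, hy⟩ _ |>.1 (h ⟨y, hy⟩ hyS)
      exact ⟨u, hu, fun z hz ↦ hu' (show (⟨z, hz.2⟩ : K) ∈ _ from hz.1)⟩
  · rintro h ⟨y, hy⟩ hyS
    exact preimage_coe_mem_nhds_subtype.2 (h y hy hyS)

/-- A compact Hausdorff space is locally compact, so test compact sets can be shrunk into a given
relative neighbourhood. -/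
theorem exists_compact_subset_mem_nhdsWithin [T2Space Y] {K O : Set Y} (hK : IsCompact K) {y : Y}
    (hy : y ∈ K) (hO : O ∈ 𝓝[K] y) : ∃ L, IsCompact L ∧ L ⊆ K ∩ O ∧ y ∈ L ∧ L ∈ 𝓝[K] y := by
  have : CompactSpace K := isCompact_iff_compactSpace.1 hK
  obtain ⟨L, hL, hL', hLc⟩ := local_compact_nhds (preimage_coe_mem_nhds_subtype.2 hO :
    ((↑) : K → Y) ⁻¹' O ∈ 𝓝 (⟨y, hy⟩ : K))
  have hmem : ((↑) : K → Y) '' L ∈ 𝓝[K] y := by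
    have := Filter.image_mem_map (m := ((↑) : K → Y)) hL
    rwa [map_nhds_subtype_val] at this
  refine ⟨(↑) '' L, hLc.image continuous_subtype_val, ?_, mem_of_mem_nhdsWithin hy hmem, hmem⟩
  rintro _ ⟨z, hz, rfl⟩
  exact ⟨z.2, hL' hz⟩

theorem continuous_compactCoherentification_mk_comp [CompactlyCoherentSpace A] {f : A → Y}
    (hf : Continuous f) : Continuous (CompactCoherentification.mk Y ∘ f) :=
  (continuous_map_of_continuous hf).comp continuous_mk

theorem KContinuous.comp_continuous {f : A → Y} {g : Z → A} (hf : KContinuous f)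
    (hg : Continuous g) : KContinuous (f ∘ g) :=
  Continuous.comp (g := f ∘ (CompactCoherentification.mk A).symm)
    (f := CompactCoherentification.map g) hf (continuous_map_of_continuous hg)

theorem Continuous.comp_kContinuous {f : A → Y} {g : Y → Z} (hg : Continuous g)
    (hf : KContinuous f) : KContinuous (g ∘ f) :=
  Continuous.comp (f := f ∘ (CompactCoherentification.mk A).symm) hg hf

/-- The tube lemma for compactly open sets. -/
theorem isOpen_setOf_forall_mem_of_compactCoherentification [CompactlyCoherentSpace A]
    {W : Set (CompactCoherentification (A × Y))} (hW : IsOpen W) {L : Set Y} (hL : IsCompact L) :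
    IsOpen {x : A | ∀ y ∈ L, CompactCoherentification.mk _ (x, y) ∈ W} := by
  have h : IsOpen ((CompactCoherentification.mk A).symm ⁻¹'
      {x : A | ∀ y ∈ L, CompactCoherentification.mk _ (x, y) ∈ W}) := by
    rw [CompactCoherentification.isOpen_iff_nhdsWithin]
    intro K hK x hx hxW
    have : CompactSpace L := isCompact_iff_compactSpace.1 hL
    -- On the compact box `K × L` the set `W` is relatively open, so the usual tube argument over
    -- the compact space `L` applies.
    have key : ∀ y ∈ (Set.univ : Set L), {p : A × L | CompactCoherentification.mk _
        (p.1, (p.2 : Y)) ∈ W} ∈ 𝓝[K] x ×ˢ 𝓝 y := by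
      intro y _
      have h1 := CompactCoherentification.isOpen_iff_nhdsWithin.1 hW _ (hK.prod hL) (x, (y : Y))
        ⟨hx, y.2⟩ (hxW y y.2)
      rw [nhdsWithin_prod_eq] at h1
      have h2 : Filter.Tendsto (fun p : A × L ↦ (p.1, (p.2 : Y))) (𝓝[K] x ×ˢ 𝓝 y)
          (𝓝[K] x ×ˢ 𝓝[L] (y : Y)) := by
        refine Filter.Tendsto.prodMap Filter.tendsto_id ?_
        rw [← map_nhds_subtype_val]
        exact Filter.tendsto_map
      exact h2 h1
    have := isCompact_univ.mem_prod_nhdsSet_of_forall key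
    rw [nhdsSet_univ] at this
    filter_upwards [Filter.mem_prod_top.1 this] with z hz y hy
    exact hz ⟨y, hy⟩
  exact h.preimage continuous_mk

/-- A path component of an open `W` contains a box around each of its points `(x, y)`, relative to a
compact box: a compact relative neighbourhood `L` of `y` is reached inside the slice over `x`, the
tube lemma thickens `{x} × L` inside `W`, and then one moves in `A` with the second coordinate
fixed. -/
theorem locallyPathConnectedSpace_compactCoherentification_prod [T2Space A] [T2Space Y]
    [CompactlyCoherentSpace A] [LocallyPathConnectedSpace A]
    [LocallyPathConnectedSpace (CompactCoherentification Y)] :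
    LocallyPathConnectedSpace (CompactCoherentification (A × Y)) := by
  rw [locallyPathConnectedSpace_iff_isOpen_pathComponentIn]
  intro z W hW
  refine CompactCoherentification.isOpen_iff_nhdsWithin.2 ?_
  rintro K hK ⟨x, y⟩ hxy hP
  have hK₁ : IsCompact (Prod.fst '' K) := hK.image continuous_fst
  have hK₂ : IsCompact (Prod.snd '' K) := hK.image continuous_snd
  have hx : x ∈ Prod.fst '' K := ⟨_, hxy, rfl⟩
  have hy : y ∈ Prod.snd '' K := ⟨_, hxy, rfl⟩
  have hsub : K ⊆ (Prod.fst '' K) ×ˢ (Prod.snd '' K) := fun p hp ↦ ⟨⟨p, hp, rfl⟩, ⟨p, hp, rfl⟩⟩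
  -- The test compact set may be replaced by the product of its two projections.
  refine nhdsWithin_mono _ hsub ?_
  have hxW : CompactCoherentification.mk (A × Y) (x, y) ∈ W := hP.target_mem
  have hvert : Continuous (CompactCoherentification.map (fun y' : Y ↦ (x, y'))) :=
    continuous_map_of_continuous (by fun_prop)
  have hC : IsOpen (pathComponentIn (CompactCoherentification.map (fun y' : Y ↦ (x, y')) ⁻¹' W)
    (CompactCoherentification.mk Y y)) := (hW.preimage hvert).pathComponentIn _
  have hmk : CompactCoherentification.mk Y y ∈ pathComponentIn (CompactCoherentification.map
      (fun y' : Y ↦ (x, y')) ⁻¹' W) (CompactCoherentification.mk Y y) :=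
    mem_pathComponentIn_self hxW
  have hyC := CompactCoherentification.isOpen_iff_nhdsWithin.1 hC _ hK₂ y hy hmk
  obtain ⟨L, hL, hLsub, hyL, hLmem⟩ := exists_compact_subset_mem_nhdsWithin hK₂ hy hyC
  have hV := isOpen_setOf_forall_mem_of_compactCoherentification hW hL
  have hxV : x ∈ {x : A | ∀ y ∈ L, CompactCoherentification.mk _ (x, y) ∈ W} := fun y' hy' ↦
    (hLsub hy').2.target_mem
  have hV₀ := (hV.pathComponentIn x).mem_nhds (mem_pathComponentIn_self hxV)
  rw [nhdsWithin_prod_eq]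
  refine Filter.mem_of_superset (Filter.prod_mem_prod (mem_nhdsWithin_of_mem_nhds hV₀) hLmem) ?_
  rintro ⟨x', y'⟩ ⟨⟨α, hα⟩, hy'⟩
  obtain ⟨β, hβ⟩ := (hLsub hy').2
  refine JoinedIn.trans hP (JoinedIn.trans (y := CompactCoherentification.mk (A × Y) (x, y'))
    ⟨β.map hvert, fun t ↦ hβ t⟩ ⟨α.map (continuous_compactCoherentification_mk_comp
      (f := fun a : A ↦ (a, y')) (by fun_prop)), fun t ↦ hα t y' hy'⟩)

theorem Homeomorph.locallyPathConnectedSpace_compactCoherentification (e : Y ≃ₜ Z)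
    [LocallyPathConnectedSpace (CompactCoherentification Y)] :
    LocallyPathConnectedSpace (CompactCoherentification Z) := by
  let e' : CompactCoherentification Y ≃ₜ CompactCoherentification Z :=
    { toFun := CompactCoherentification.map e
      invFun := CompactCoherentification.map e.symm
      left_inv := e.left_inv
      right_inv := e.right_inv
      continuous_toFun := continuous_map_of_continuous e.continuous
      continuous_invFun := continuous_map_of_continuous e.symm.continuous }
  exact e'.symm.isOpenEmbedding.locallyPathConnectedSpace

/-- Peel off one factor at a time. The ordinary product of the remaining factors need not be
compactly generated, which is why the binary lemma only assumes its refinement to be locally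
path-connected. -/
theorem locallyPathConnectedSpace_compactCoherentification_pi {k : ℕ} {B : Fin k → Type*}
    [∀ i, TopologicalSpace (B i)] [∀ i, T2Space (B i)] [∀ i, CompactlyCoherentSpace (B i)]
    [∀ i, LocallyPathConnectedSpace (B i)] :
    LocallyPathConnectedSpace (CompactCoherentification (∀ i, B i)) := by
  induction k with
  | zero =>
    have : Subsingleton (CompactCoherentification (∀ i, B i)) :=
      (CompactCoherentification.mk _).symm.subsingleton
    rw [locallyPathConnectedSpace_iff_isOpen_pathComponentIn]
    intro x u _
    exact isOpen_discrete _
  | succ k ih =>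
    have := ih (B := fun i ↦ B i.succ)
    have := locallyPathConnectedSpace_compactCoherentification_prod (A := B 0)
      (Y := ∀ i : Fin k, B i.succ)
    let e : (B 0 × ∀ i : Fin k, B i.succ) ≃ₜ ∀ i, B i :=
      { toEquiv := Fin.consEquiv B
        continuous_toFun := by
          refine continuous_pi fun i ↦ ?_
          refine Fin.cases ?_ (fun j ↦ ?_) i
          · exact continuous_fst
          · exact (continuous_apply j).comp continuous_snd
        continuous_invFun := (continuous_apply 0).prodMk
          (continuous_pi fun i ↦ continuous_apply _) }
    exact e.locallyPathConnectedSpace_compactCoherentification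

/-- Paths and homotopies have compact domains, so they are the same for a space and for its
refinement. -/
theorem simplyConnectedSpace_compactCoherentification [SimplyConnectedSpace Y] :
    SimplyConnectedSpace (CompactCoherentification Y) := by
  let l {x y : Y} (p : Path x y) : Path (CompactCoherentification.mk Y x)
      (CompactCoherentification.mk Y y) := p.map' (f := CompactCoherentification.mk Y)
        (continuousOn_isCompact_mk (isCompact_range p.continuous))
  rw [simply_connected_iff_paths_homotopic']
  refine ⟨⟨⟨CompactCoherentification.mk Y (Classical.arbitrary Y)⟩, fun x y ↦
    ⟨l (PathConnectedSpace.somePath ((CompactCoherentification.mk Y).symm x)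
      ((CompactCoherentification.mk Y).symm y))⟩⟩, fun {x y} p q ↦ ?_⟩
  obtain ⟨H⟩ := SimplyConnectedSpace.paths_homotopic (p.map continuous_mk_symm)
    (q.map continuous_mk_symm)
  exact ⟨{  toFun := CompactCoherentification.mk Y ∘ H
            continuous_toFun := continuous_mk_comp_iff_of_compactSpace.2 H.continuous
            map_zero_left := H.map_zero_left
            map_one_left := H.map_one_left
            prop' := H.prop' }⟩

instance SimplyConnectedSpace.prod [SimplyConnectedSpace A] [SimplyConnectedSpace B] :
    SimplyConnectedSpace (A × B) := by
  rw [simply_connected_iff_paths_homotopic]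
  refine ⟨inferInstance, fun x y ↦ ⟨fun p q ↦ ?_⟩⟩
  rw [← Path.Homotopic.prod_projLeft_projRight p, ← Path.Homotopic.prod_projLeft_projRight q]
  congr 1 <;> exact Subsingleton.elim _ _

instance SimplyConnectedSpace.pi {ι : Type*} {B : ι → Type*} [∀ i, TopologicalSpace (B i)]
    [∀ i, SimplyConnectedSpace (B i)] : SimplyConnectedSpace (∀ i, B i) := by
  rw [simply_connected_iff_paths_homotopic]
  refine ⟨inferInstance, fun x y ↦ ⟨fun p q ↦ ?_⟩⟩
  rw [← Path.Homotopic.pi_proj p, ← Path.Homotopic.pi_proj q]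
  congr 1
  funext i
  exact Subsingleton.elim _ _

end CompactCoherentification

/-! ### Coverings of compactly generated spaces -/

section Covering

variable {E X : Type*} [TopologicalSpace E] [TopologicalSpace X] {p : E → X}

theorem IsCoveringMap.t2Space [T2Space X] (hp : IsCoveringMap p) : T2Space E := by
  refine ⟨fun a b hab ↦ ?_⟩
  by_cases h : p a = p b
  · exact hp.isSeparatedMap a b h hab
  · obtain ⟨u, v, hu, hv, ha, hb, huv⟩ := t2_separation h
    exact ⟨p ⁻¹' u, p ⁻¹' v, hu.preimage hp.continuous, hv.preimage hp.continuous, ha, hb,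
      huv.preimage p⟩

/-- Through a local inverse, a test compact set in the base, shrunk into the chart, becomes a
compact set upstairs, so compact openness descends to the base, where it is openness. -/
theorem IsLocalHomeomorph.compactlyCoherentSpace [T2Space X] [CompactlyCoherentSpace X]
    (hp : IsLocalHomeomorph p) : CompactlyCoherentSpace E := by
  refine CompactlyCoherentSpace.of_isOpen fun S hS ↦ isOpen_iff_mem_nhds.2 fun a ha ↦ ?_
  have hS' : IsOpen (CompactCoherentification.mk E '' S) := by
    rw [CompactCoherentification.isOpen_iff, Equiv.preimage_image]
    exact hS
  rw [CompactCoherentification.isOpen_iff_nhdsWithin, Equiv.preimage_image] at hS'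
  obtain ⟨e, hae, rfl⟩ := hp a
  have hO : IsOpen (e.symm ⁻¹' S ∩ e.target) := by
    have : IsOpen (CompactCoherentification.mk X '' (e.symm ⁻¹' S ∩ e.target)) := by
      rw [CompactCoherentification.isOpen_iff_nhdsWithin, Equiv.preimage_image]
      rintro K hK x hx ⟨hxS, hxe⟩
      obtain ⟨L, hL, hLsub, hxL, hLmem⟩ := exists_compact_subset_mem_nhdsWithin hK hx
        (mem_nhdsWithin_of_mem_nhds (e.open_target.mem_nhds hxe))
      have hcont : ContinuousOn e.symm L :=
        e.continuousOn_symm.mono fun z hz ↦ (hLsub hz).2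
      have h1 := hS' _ (hL.image_of_continuousOn hcont) _ ⟨x, hxL, rfl⟩ hxS
      have h2 : Filter.Tendsto e.symm (𝓝[L] x) (𝓝[e.symm '' L] (e.symm x)) :=
        tendsto_nhdsWithin_of_tendsto_nhds_of_eventually_within _ (hcont x hxL)
          (Filter.eventually_of_mem self_mem_nhdsWithin fun z hz ↦ ⟨z, hz, rfl⟩)
      -- Shrinking `K` to a relative neighbourhood `L` does not change the filter at `x`.
      have h3 : 𝓝[L] x = 𝓝[K] x := by
        refine le_antisymm (nhdsWithin_mono _ fun z hz ↦ (hLsub hz).1) ?_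
        rw [nhdsWithin, nhdsWithin]
        exact le_inf inf_le_left (Filter.le_principal_iff.2 hLmem)
      rw [h3] at h2
      filter_upwards [h2 h1, mem_nhdsWithin_of_mem_nhds (e.open_target.mem_nhds hxe)] with z hz hz'
      exact ⟨hz, hz'⟩
    have := this.preimage CompactCoherentification.continuous_mk
    rwa [Equiv.preimage_image] at this
  have h4 := e.continuousAt hae (hO.mem_nhds ⟨by simpa [e.left_inv hae] using ha, e.map_source hae⟩)
  filter_upwards [h4, e.open_source.mem_nhds hae] with z hz hz'
  have := hz.1
  rwa [Set.mem_preimage, e.left_inv hz'] at this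

theorem IsLocalHomeomorph.locallyPathConnectedSpace [LocallyPathConnectedSpace X]
    (hp : IsLocalHomeomorph p) : LocallyPathConnectedSpace E := by
  rw [locallyPathConnectedSpace_iff_pathComponentIn_mem_nhds]
  intro a u hu hau
  obtain ⟨e, hae, rfl⟩ := hp a
  have hO := e.symm.isOpen_inter_preimage hu
  obtain ⟨V, ⟨hV, hVc⟩, hVsub⟩ := (path_connected_basis (e a)).mem_iff.1
    (hO.mem_nhds ⟨e.map_source hae, by simpa [e.left_inv hae] using hau⟩)
  have h4 := e.continuousAt hae hV
  filter_upwards [h4, e.open_source.mem_nhds hae] with z hz hz'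
  obtain ⟨γ, hγ⟩ := hVc.joinedIn (e a) (mem_of_mem_nhds hV) (e z) hz
  refine ⟨((γ.map' (f := e.symm) (e.continuousOn_symm.mono ?_)).cast (e.left_inv hae).symm
    (e.left_inv hz').symm), fun t ↦ (hVsub (hγ t)).2⟩
  rintro _ ⟨t, rfl⟩
  exact (hVsub (hγ t)).1

end Covering

theorem Path.Homotopic.Quotient.trans_right_cancel {X : Type*} [TopologicalSpace X] {x y z : X}
    {p q : Path.Homotopic.Quotient x y} {r : Path.Homotopic.Quotient y z}
    (h : p.trans r = q.trans r) : p = q := by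
  have := congrArg (·.trans r.symm) h
  simpa using this

theorem Path.Homotopic.Quotient.trans_left_cancel {X : Type*} [TopologicalSpace X] {x y z : X}
    {r : Path.Homotopic.Quotient x y} {p q : Path.Homotopic.Quotient y z}
    (h : r.trans p = r.trans q) : p = q := by
  have := congrArg (r.symm.trans ·) h
  simpa [← Path.Homotopic.Quotient.trans_assoc] using this

/-- The loop `γ · γ'⁻¹` at `x` is null-homotopic, and `γ'` can be cancelled. -/
theorem SemilocallySimplyConnected.exists_isOpen {X : Type*} [TopologicalSpace X]
    (h : SemilocallySimplyConnected X) (x : X) : ∃ U : Set X, IsOpen U ∧ x ∈ U ∧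
      ∀ (y : X) (γ γ' : Path x y), Set.range γ ⊆ U → Set.range γ' ⊆ U → γ.Homotopic γ' := by
  obtain ⟨V, hV, hV'⟩ := h x
  obtain ⟨U, hUV, hU, hx⟩ := mem_nhds_iff.1 hV
  refine ⟨U, hU, hx, fun y γ γ' hγ hγ' ↦ ?_⟩
  have := hV' (γ.trans γ'.symm) (by
    rw [Path.trans_range, Path.symm_range]
    exact (Set.union_subset hγ hγ').trans hUV)
  rw [← Path.Homotopic.Quotient.eq] at this ⊢
  refine Path.Homotopic.Quotient.trans_right_cancel (r := (Path.Homotopic.Quotient.mk γ').symm) ?_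
  simpa using this

/-! ### Topology, path lifting and simple connectedness of the universal cover -/

namespace UnivCover

variable {X : Type*} [TopologicalSpace X] {e : X}

theorem mem_nhd_self {a : UnivCover X e} {U : Set X} (h : a.proj ∈ U) : a ∈ a.nhd U :=
  ⟨Path.refl _, by simpa [proj] using h, by simp⟩

theorem mem_nhd_trans {a b c : UnivCover X e} {U : Set X} (h : b ∈ a.nhd U) (h' : c ∈ b.nhd U) :
    c ∈ a.nhd U := by
  obtain ⟨η, hη, hb⟩ := h
  obtain ⟨η', hη', hc⟩ := h'
  refine ⟨η.trans η', ?_, by simp [hb, hc]⟩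
  rw [Path.trans_range]
  exact Set.union_subset hη hη'

theorem nhd_mono (a : UnivCover X e) {U V : Set X} (h : U ⊆ V) : a.nhd U ⊆ a.nhd V :=
  fun _ ⟨η, hη, hb⟩ ↦ ⟨η, hη.trans h, hb⟩

theorem proj_mem_of_mem_nhd {a b : UnivCover X e} {U : Set X} (h : b ∈ a.nhd U) : b.proj ∈ U := by
  obtain ⟨η, hη, -⟩ := h
  exact hη ⟨1, η.target⟩

theorem isTopologicalBasis_nhd : TopologicalSpace.IsTopologicalBasis
    {S | ∃ (a : UnivCover X e) (U : Set X), IsOpen U ∧ a.proj ∈ U ∧ S = a.nhd U} where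
  exists_subset_inter := by
    rintro _ ⟨a, U, hU, -, rfl⟩ _ ⟨b, V, hV, -, rfl⟩ c ⟨hc, hc'⟩
    refine ⟨_, ⟨c, U ∩ V, hU.inter hV, ⟨proj_mem_of_mem_nhd hc, proj_mem_of_mem_nhd hc'⟩, rfl⟩,
      mem_nhd_self ⟨proj_mem_of_mem_nhd hc, proj_mem_of_mem_nhd hc'⟩, fun d hd ↦
      ⟨mem_nhd_trans hc (nhd_mono _ Set.inter_subset_left hd),
        mem_nhd_trans hc' (nhd_mono _ Set.inter_subset_right hd)⟩⟩
  sUnion_eq := Set.eq_univ_of_forall fun a ↦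
    ⟨_, ⟨a, Set.univ, isOpen_univ, trivial, rfl⟩, mem_nhd_self trivial⟩
  eq_generateFrom := rfl

theorem mem_nhds_iff {a : UnivCover X e} {S : Set (UnivCover X e)} :
    S ∈ 𝓝 a ↔ ∃ U, IsOpen U ∧ a.proj ∈ U ∧ a.nhd U ⊆ S := by
  rw [isTopologicalBasis_nhd.mem_nhds_iff]
  constructor
  · rintro ⟨_, ⟨b, U, hU, -, rfl⟩, ha, hS⟩
    exact ⟨U, hU, proj_mem_of_mem_nhd ha, fun c hc ↦ hS (mem_nhd_trans ha hc)⟩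
  · rintro ⟨U, hU, ha, hS⟩
    exact ⟨_, ⟨a, U, hU, ha, rfl⟩, mem_nhd_self ha, hS⟩

theorem continuous_proj : Continuous (proj : UnivCover X e → X) := by
  refine continuous_iff_continuousAt.2 fun a S hS ↦ ?_
  obtain ⟨U, hUS, hU, ha⟩ := _root_.mem_nhds_iff.1 hS
  exact mem_nhds_iff.2 ⟨U, hU, ha, fun b hb ↦ hUS (proj_mem_of_mem_nhd hb)⟩

theorem isOpenMap_proj [LocallyPathConnectedSpace X] : IsOpenMap (proj : UnivCover X e → X) := by
  refine IsOpenMap.of_nhds_le fun a S hS ↦ ?_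
  obtain ⟨U, hU, ha, hS⟩ := mem_nhds_iff.1 hS
  filter_upwards [(hU.pathComponentIn a.proj).mem_nhds (mem_pathComponentIn_self ha)] with x hx
  obtain ⟨η, hη⟩ := hx
  exact hS (show (⟨x, a.2.trans (.mk η)⟩ : UnivCover X e) ∈ a.nhd U from
    ⟨η, Set.range_subset_iff.2 hη, rfl⟩)

theorem surjective_proj [PathConnectedSpace X] :
    Function.Surjective (proj : UnivCover X e → X) := fun x ↦
  ⟨mk (PathConnectedSpace.somePath e x), rfl⟩

/-- The class of `α · δ` for `a = [α]`. -/
noncomputable def extend (a : UnivCover X e) {x : X} (δ : Path a.proj x) : UnivCover X e :=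
  ⟨x, a.2.trans (.mk δ)⟩

theorem extend_refl (a : UnivCover X e) : a.extend (Path.refl a.proj) = a :=
  congrArg (Sigma.mk a.1) (Path.Homotopic.Quotient.trans_refl a.2)

theorem extend_congr (a : UnivCover X e) {x y : X} {δ : Path a.proj x} {δ' : Path a.proj y}
    (h : ∀ t, δ t = δ' t) : a.extend δ = a.extend δ' := by
  have hxy : x = y := by simpa using h 1
  subst hxy
  rw [show δ = δ' from Path.ext (funext h)]

theorem extend_trans (a : UnivCover X e) {x y : X} (δ : Path a.proj x) (δ' : Path x y) :
    a.extend (δ.trans δ') = (a.extend δ).extend δ' :=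
  congrArg (Sigma.mk y) (Path.Homotopic.Quotient.trans_assoc a.2 (.mk δ) (.mk δ')).symm

theorem extend_homotopic (a : UnivCover X e) {x : X} {δ δ' : Path a.proj x}
    (h : δ.Homotopic δ') : a.extend δ = a.extend δ' :=
  congrArg (fun p ↦ (⟨x, a.2.trans p⟩ : UnivCover X e)) (Path.Homotopic.Quotient.eq.2 h)

/-- The path `t ↦ [α · δ|_{[0, t]}]` in the universal cover. -/
noncomputable def liftPath (a : UnivCover X e) {x : X} (δ : Path a.proj x) :
    Path a (a.extend δ) where
  toFun t := a.extend ((δ.subpath 0 t).cast δ.source.symm rfl)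
  continuous_toFun := by
    refine continuous_iff_continuousAt.2 fun t S hS ↦ ?_
    obtain ⟨U, hU, ht, hS⟩ := mem_nhds_iff.1 hS
    -- For `s` close to `t` the whole piece of `δ` between `t` and `s` stays in `U`, by compactness
    -- of the parameter interval.
    have hev : ∀ᶠ s in 𝓝 t, ∀ r ∈ (Set.univ : Set unitInterval), δ.subpath t s r ∈ U := by
      refine isCompact_univ.eventually_forall_of_forall_eventually fun r _ ↦ ?_
      have hc : Continuous fun z : unitInterval × unitInterval ↦ δ.subpath t z.1 z.2 :=
        δ.subpath_continuous_family.comp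
          (continuous_const.prodMk (continuous_fst.prodMk continuous_snd))
      have ht' : δ t ∈ U := ht
      exact hc.continuousAt (hU.mem_nhds (by simpa using ht'))
    refine Filter.mem_map.2 ?_
    filter_upwards [hev] with s hs
    refine hS ?_
    have h : a.extend ((δ.subpath 0 s).cast δ.source.symm rfl) =
        (a.extend ((δ.subpath 0 t).cast δ.source.symm rfl)).extend (δ.subpath t s) := by
      rw [← extend_trans]
      exact extend_homotopic _ (Path.Homotopic.pathCast
        ⟨(Path.Homotopy.subpathTransSubpath δ 0 t s).symm⟩ δ.source.symm rfl)
    change a.extend _ ∈ _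
    rw [h]
    exact ⟨δ.subpath t s, Set.range_subset_iff.2 fun r ↦ hs r trivial, rfl⟩
  source' := by
    refine (extend_congr a (δ' := Path.refl _) fun t ↦ ?_).trans (extend_refl a)
    simp
  target' := extend_congr a fun t ↦ by simp

theorem mk_eq_extend_base {x : X} (α : Path e x) : mk α = (base e).extend α :=
  congrArg (Sigma.mk x) (Path.Homotopic.Quotient.refl_trans _).symm

theorem exists_extend_base (a : UnivCover X e) : ∃ α : Path e a.proj, a = mk α := by
  obtain ⟨x, p⟩ := a
  induction p with | mk α => exact ⟨α, rfl⟩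

instance : PathConnectedSpace (UnivCover X e) where
  nonempty := ⟨base e⟩
  joined := by
    have key : ∀ a : UnivCover X e, Joined (base e) a := fun a ↦ by
      obtain ⟨α, h⟩ := exists_extend_base a
      rw [h, mk_eq_extend_base]
      exact ⟨liftPath _ _⟩
    exact fun a b ↦ (key a).symm.trans (key b)

/-- `liftPath` lifts the projection of `Γ` from the same start, hence agrees with `Γ` by uniqueness
of lifts. -/
theorem extend_eq_of_continuous (hp : IsCoveringMap (proj : UnivCover X e → X))
    {a b : UnivCover X e} (Γ : Path a b) : a.extend (Γ.map continuous_proj) = b := by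
  have h := hp.eq_of_comp_eq (a.liftPath (Γ.map continuous_proj)).continuous Γ.continuous rfl 0
    (by simp)
  simpa using congrFun h 1

/-- The end point of a path records the class of its projection, so two paths with common end points
have homotopic projections, and homotopies lift. -/
theorem simplyConnectedSpace (hp : IsCoveringMap (proj : UnivCover X e → X)) :
    SimplyConnectedSpace (UnivCover X e) := by
  rw [simply_connected_iff_paths_homotopic]
  refine ⟨inferInstance, fun a b ↦ ⟨fun p q ↦ ?_⟩⟩
  refine hp.injective_path_homotopic_map a b ?_
  induction p with | mk p =>
  induction q with | mk q =>
  have h := (extend_eq_of_continuous hp p).trans (extend_eq_of_continuous hp q).symm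
  exact Path.Homotopic.Quotient.trans_left_cancel (eq_of_heq (Sigma.mk.inj h).2)

/-- The projection is injective on a sheet `a.nhd U` as soon as paths in `U` from `a.proj` are
determined up to homotopy by their end points. -/
theorem eq_of_mem_nhd {a b c : UnivCover X e} {U : Set X}
    (hU : ∀ (y : X) (γ γ' : Path a.proj y), Set.range γ ⊆ U → Set.range γ' ⊆ U → γ.Homotopic γ')
    (hb : b ∈ a.nhd U) (hc : c ∈ a.nhd U) (h : b.proj = c.proj) : b = c := by
  obtain ⟨η, hη, hb⟩ := hb
  obtain ⟨η', hη', hc⟩ := hc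
  obtain ⟨x, p⟩ := b
  obtain ⟨y, q⟩ := c
  change x = y at h
  subst h
  change Path a.proj x at η η'
  change p = a.2.trans (.mk η) at hb
  change q = a.2.trans (.mk η') at hc
  subst hb hc
  exact extend_homotopic a (hU _ η η' hη hη')

end UnivCover

/-! ### The group of lifted translations acting on the universal cover -/

namespace OrbitPi1

variable {G X : Type*} [TopologicalSpace X] [Group G] [MulAction G X] [ContinuousConstSMul G X]
  {e : X}

theorem proj_smul (p : OrbitPi1 G X e) (z : UnivCover X e) :
    (p • z).proj = p.toGroup • z.proj := rfl

/-- Cancel the translated class of `z` on the right. With `exists_smul_eq`, this makes a lifted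
translation determined by its group element and one value. -/
theorem eq_of_smul_eq {p q : OrbitPi1 G X e} (h : p.toGroup = q.toGroup) {z : UnivCover X e}
    (hz : p • z = q • z) : p = q := by
  obtain ⟨g, f⟩ := p
  obtain ⟨g', f'⟩ := q
  change g = g' at h
  subst h
  exact congrArg (Sigma.mk g) (Path.Homotopic.Quotient.trans_right_cancel
    (eq_of_heq (Sigma.mk.inj hz).2))

/-- Follow `w` and then the reverse of the translate of `z`: this runs from `e` to `g • e`. -/
theorem exists_smul_eq (g : G) {z w : UnivCover X e} (h : w.proj = g • z.proj) :
    ∃ p : OrbitPi1 G X e, p.toGroup = g ∧ p • z = w := by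
  obtain ⟨x, f⟩ := w
  change x = g • z.1 at h
  subst h
  refine ⟨⟨g, f.trans (z.2.translate g).symm⟩, rfl, ?_⟩
  refine congrArg (Sigma.mk _) ?_
  change (f.trans (z.2.translate g).symm).trans (z.2.translate g) = f
  simp

theorem surjective_toGroup [PathConnectedSpace X] :
    Function.Surjective (toGroup : OrbitPi1 G X e →* G) := fun g ↦
  ⟨mk g (PathConnectedSpace.somePath _ _), rfl⟩

theorem mk_smul_base (g : G) (f : Path e (g • e)) :
    mk g f • UnivCover.base e = UnivCover.mk f :=
  congrArg (Sigma.mk (g • e)) (Path.Homotopic.Quotient.trans_refl _)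

-- Fibres are orbits by `exists_smul_eq` over `1`. An element of the kernel that moves a sheet to
-- meet itself fixes a point there, by injectivity of the projection on the sheet, and is therefore
-- trivial.
variable (G X e) in
theorem isQuotientCoveringMap_proj [PathConnectedSpace X] [LocallyPathConnectedSpace X]
    (hX : SemilocallySimplyConnected X) :
    IsQuotientCoveringMap (UnivCover.proj : UnivCover X e → X) (pi1 G X e) where
  toIsQuotientMap := UnivCover.isOpenMap_proj.isQuotientMap UnivCover.continuous_proj
    UnivCover.surjective_proj
  continuous_const_smul g := continuous_const_smul (g : OrbitPi1 G X e)
  apply_eq_iff_mem_orbit {z w} := by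
    constructor
    · intro h
      obtain ⟨p, hp, hpw⟩ := exists_smul_eq (1 : G) (z := w) (w := z) (by rwa [one_smul])
      exact ⟨⟨p, hp⟩, hpw⟩
    · rintro ⟨⟨p, hp⟩, rfl⟩
      change (p • w).proj = w.proj
      rw [proj_smul, MonoidHom.mem_ker.1 hp, one_smul]
  disjoint z := by
    obtain ⟨U, hU, hz, hU'⟩ := hX.exists_isOpen z.proj
    refine ⟨z.nhd U, UnivCover.mem_nhds_iff.2 ⟨U, hU, hz, subset_rfl⟩, ?_⟩
    rintro ⟨p, hp⟩ ⟨_, ⟨w, hw, rfl⟩, hw'⟩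
    have h := UnivCover.eq_of_mem_nhd hU' hw' hw (by
      change (p • w).proj = w.proj
      rw [proj_smul, MonoidHom.mem_ker.1 hp, one_smul])
    exact Subtype.ext (eq_of_smul_eq (z := w) ((MonoidHom.mem_ker.1 hp).trans (map_one _).symm)
      (h.trans (one_smul _ _).symm))

/-- Two smallness conditions are intersected: `V'` forces elements with overlapping translates to
have the same image in `G`, and `U` makes the projection injective on the sheet. -/
theorem isCoveringAction (hX : SemilocallySimplyConnected X) (hG : IsCoveringAction G X) :
    IsCoveringAction (OrbitPi1 G X e) (UnivCover X e) := by
  intro z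
  obtain ⟨U, hU, hz, hU'⟩ := hX.exists_isOpen z.proj
  obtain ⟨V, hV, hV'⟩ := hG z.proj
  obtain ⟨V', hVV', hVo, hzV⟩ := mem_nhds_iff.1 hV
  refine ⟨z.nhd (U ∩ V'), UnivCover.mem_nhds_iff.2 ⟨_, hU.inter hVo, ⟨hz, hzV⟩, subset_rfl⟩, ?_⟩
  rintro p q ⟨_, ⟨w, hw, rfl⟩, w', hw', h⟩
  dsimp only at h
  have hproj := congrArg UnivCover.proj h
  rw [proj_smul, proj_smul] at hproj
  have hpq : q.toGroup = p.toGroup := hV' _ _ ⟨_, ⟨w'.proj,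
    hVV' (UnivCover.proj_mem_of_mem_nhd hw').2, rfl⟩, w.proj,
    hVV' (UnivCover.proj_mem_of_mem_nhd hw).2, hproj.symm⟩
  rw [hpq] at hproj
  have := UnivCover.eq_of_mem_nhd hU' (UnivCover.nhd_mono _ Set.inter_subset_left hw')
    (UnivCover.nhd_mono _ Set.inter_subset_left hw) (smul_left_cancel _ hproj)
  subst this
  exact (eq_of_smul_eq hpq h).symm

end OrbitPi1

/-! ### Fundamental groups of orbit spaces -/

namespace IsCoveringAction

variable {G X : Type*} [TopologicalSpace X] [Group G] [MulAction G X] [ContinuousConstSMul G X]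

theorem eq_of_smul_eq (hG : IsCoveringAction G X) {g h : G} {x : X} (hx : g • x = h • x) :
    g = h := by
  obtain ⟨U, hU, hU'⟩ := hG x
  exact hU' g h ⟨_, ⟨x, mem_of_mem_nhds hU, rfl⟩, x, mem_of_mem_nhds hU, hx.symm⟩

theorem isQuotientCoveringMap (hG : IsCoveringAction G X) :
    IsQuotientCoveringMap (Quotient.mk (MulAction.orbitRel G X)) G where
  toIsQuotientMap := isQuotientMap_quotient_mk'
  apply_eq_iff_mem_orbit := Quotient.eq''
  disjoint x := by
    obtain ⟨U, hU, hU'⟩ := hG x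
    refine ⟨U, hU, fun g hg ↦ hU' g 1 ?_⟩
    simpa using hg

end IsCoveringAction

namespace OrbitPi1

variable {G X : Type*} [TopologicalSpace X] [Group G] [MulAction G X] [ContinuousConstSMul G X]
  {e : X}

/-- Representing paths can be compared pointwise, since the translation by `g` in the product
disappears in the orbit space. -/
theorem toLoop_mul (p q : OrbitPi1 G X e) : (p * q).toLoop = p.toLoop.trans q.toLoop := by
  obtain ⟨g, f⟩ := p
  obtain ⟨g', f'⟩ := q
  induction f with | mk f =>
  induction f' with | mk f' =>
  refine congrArg Path.Homotopic.Quotient.mk ?_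
  ext t
  simp only [Path.cast_coe, Path.map_coe, Function.comp_apply, Path.trans_apply]
  split_ifs with h
  · rfl
  · exact Quotient.sound ⟨g, rfl⟩

/-- Lift loops of the orbit space from `e`. The lift ends in the orbit of `e`, which gives
surjectivity. Its end point determines the group element because the action is free, and then its
class is determined by homotopy lifting. -/
theorem bijective_toLoop (hG : IsCoveringAction G X) :
    Function.Bijective (toLoop : OrbitPi1 G X e → _) := by
  have hq := hG.isQuotientCoveringMap.isCoveringMap
  constructor
  · intro p q hpq
    have key : ∀ r : OrbitPi1 G X e, (hq.monodromy r.toLoop ⟨e, rfl⟩).1 = r.1 • e := fun r ↦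
      congrArg Subtype.val (hq.monodromy_eq_of_map_eq (ex := ⟨e, rfl⟩)
        (ey := ⟨r.1 • e, hG.isQuotientCoveringMap.map_smul r.1⟩) r.2
        ((Path.Homotopic.Quotient.cast_cast _ _ _ _ _).trans
          (Path.Homotopic.Quotient.cast_rfl_rfl _)).symm)
    have hg : p.1 = q.1 := hG.eq_of_smul_eq ((key p).symm.trans ((congrArg (fun l ↦
      (hq.monodromy l ⟨e, rfl⟩).1) hpq).trans (key q)))
    obtain ⟨g, f⟩ := p
    obtain ⟨g', f'⟩ := q
    change g = g' at hg
    subst hg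
    refine congrArg (Sigma.mk g) (hq.injective_path_homotopic_map _ _ ?_)
    have := congrArg (·.cast rfl (hG.isQuotientCoveringMap.map_smul g)) hpq
    have hc : ∀ r : OrbitPi1 G X e, r.toLoop.cast rfl (hG.isQuotientCoveringMap.map_smul r.1) =
        r.2.map ⟨_, hq.continuous⟩ := fun r ↦
      (Path.Homotopic.Quotient.cast_cast _ _ _ _ _).trans (Path.Homotopic.Quotient.cast_rfl_rfl _)
    exact (hc ⟨g, f⟩).symm.trans (this.trans (hc ⟨g, f'⟩))
  · intro l
    obtain ⟨g, hg⟩ := hG.isQuotientCoveringMap.apply_eq_iff_mem_orbit.1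
      (hq.monodromy l ⟨e, rfl⟩).2
    refine ⟨⟨g, (hq.liftPathQuotient l ⟨e, rfl⟩).cast rfl hg⟩, ?_⟩
    have := hq.map_liftPathQuotient l ⟨e, rfl⟩
    simp only [toLoop, Path.Homotopic.Quotient.map_cast]
    rw [this]
    refine (Path.Homotopic.Quotient.cast_cast _ _ _ _ _).trans ?_
    exact (Path.Homotopic.Quotient.cast_cast _ _ _ _ _).trans
      (Path.Homotopic.Quotient.cast_rfl_rfl _)

end OrbitPi1

/-! ### Blocks -/

theorem blockEquiv_lt_iff {k n : ℕ} (m : Fin k → ℕ) (h : ∑ i, m i = n) (p q : Σ i, Fin (m i)) :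
    blockEquiv m h p < blockEquiv m h q ↔
      p.1 < q.1 ∨ ∃ e : p.1 = q.1, Fin.cast (congrArg m e) p.2 < q.2 := by
  refine ⟨LittleIntervals₀.lex_of_lt m h p q, fun hpq ↦ ?_⟩
  by_contra hcon
  rcases (not_lt.1 hcon).eq_or_lt with heq | hlt
  · obtain rfl := (blockEquiv m h).injective heq
    rcases hpq with hlt | ⟨_, hlt⟩ <;> exact lt_irrefl _ hlt
  · have hqp := LittleIntervals₀.lex_of_lt m h q p hlt
    obtain ⟨i, x⟩ := p
    obtain ⟨j, y⟩ := q
    dsimp only at hpq hqp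
    rcases hpq with hpq | ⟨e, hpq⟩
    · rcases hqp with hqp | ⟨e', -⟩
      · exact lt_asymm hpq hqp
      · exact hpq.ne' e'
    · subst e
      rcases hqp with hqp | ⟨_, hqp⟩
      · exact lt_irrefl _ hqp
      · exact lt_asymm hpq hqp

theorem eq_of_lt_imp_lt {T : Type*} {n : ℕ} {f g : T → Fin n} (hf : Function.Bijective f)
    (h : ∀ s t, f s < f t → g s < g t) : f = g := by
  let e := Equiv.ofBijective f hf
  have hmono : StrictMono (g ∘ e.symm) := fun i j hij ↦ h _ _ (by
    change e _ < e _
    simpa using hij)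
  -- `Fin n` has only one order automorphism, so the common order on `T` determines its enumeration.
  have hid : hmono.orderIsoOfSurjective _ (Finite.injective_iff_surjective.1 hmono.injective) =
      OrderIso.refl _ := Subsingleton.elim _ _
  funext t
  have : g (e.symm (e t)) = e t := DFunLike.congr_fun hid (e t)
  rw [Equiv.symm_apply_apply] at this
  exact this.symm

/-- Both sides enumerate the triples `(i, x, y)` lexicographically, and an order-preserving
enumeration is unique. -/
theorem blockEquiv_blockEquiv {k N n : ℕ} (m : Fin k → ℕ) (h : ∑ i, m i = N) (l : Fin N → ℕ)
    (h₁ : ∑ j, l j = n) (h₂ : ∑ i, ∑ x, l (blockEquiv m h ⟨i, x⟩) = n) (i : Fin k)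
    (x : Fin (m i)) (y : Fin (l (blockEquiv m h ⟨i, x⟩))) :
    blockEquiv l h₁ ⟨blockEquiv m h ⟨i, x⟩, y⟩ =
      blockEquiv (fun i ↦ ∑ x, l (blockEquiv m h ⟨i, x⟩)) h₂
        ⟨i, blockEquiv (fun x ↦ l (blockEquiv m h ⟨i, x⟩)) rfl ⟨x, y⟩⟩ := by
  let f : (Σ p : (Σ i, Fin (m i)), Fin (l (blockEquiv m h p))) → Fin n := fun r ↦
    blockEquiv l h₁ ⟨blockEquiv m h r.1, r.2⟩
  let g : (Σ p : (Σ i, Fin (m i)), Fin (l (blockEquiv m h p))) → Fin n := fun r ↦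
    blockEquiv (fun i ↦ ∑ x, l (blockEquiv m h ⟨i, x⟩)) h₂
      ⟨r.1.1, blockEquiv (fun x ↦ l (blockEquiv m h ⟨r.1.1, x⟩)) rfl ⟨r.1.2, r.2⟩⟩
  suffices hfg : f = g from congrFun hfg ⟨⟨i, x⟩, y⟩
  refine eq_of_lt_imp_lt ⟨?_, ?_⟩ ?_
  · rintro ⟨p, y⟩ ⟨q, y'⟩ hpq
    obtain ⟨e, e'⟩ := Sigma.mk.inj ((blockEquiv l h₁).injective hpq)
    have hpq' : p = q := (blockEquiv m h).injective e
    subst hpq'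
    exact congrArg (Sigma.mk p) (eq_of_heq e')
  · intro j
    obtain ⟨⟨J, y⟩, rfl⟩ := (blockEquiv l h₁).surjective j
    obtain ⟨p, rfl⟩ := (blockEquiv m h).surjective J
    exact ⟨⟨p, y⟩, rfl⟩
  · rintro ⟨⟨i, x⟩, y⟩ ⟨⟨i', x'⟩, y'⟩ hlt
    refine (blockEquiv_lt_iff _ _ _ _).2 ?_
    rcases (blockEquiv_lt_iff _ _ _ _).1 hlt with hlt | ⟨e, hlt⟩
    · rcases (blockEquiv_lt_iff _ _ _ _).1 hlt with hlt | ⟨e, hlt⟩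
      · exact Or.inl hlt
      · dsimp only at e
        subst e
        exact Or.inr ⟨rfl, (blockEquiv_lt_iff _ _ _ _).2 (Or.inl hlt)⟩
    · have e' := (blockEquiv m h).injective e
      cases e'
      exact Or.inr ⟨rfl, (blockEquiv_lt_iff _ _ _ _).2 (Or.inr ⟨rfl, hlt⟩)⟩

theorem blockEquiv_one {n : ℕ} (h : ∑ _ : Fin 1, n = n) (x : Fin n) :
    blockEquiv (fun _ : Fin 1 ↦ n) h ⟨0, x⟩ = x := by
  refine congrFun (eq_of_lt_imp_lt (f := fun x ↦ blockEquiv (fun _ : Fin 1 ↦ n) h ⟨0, x⟩)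
    (g := id) ⟨?_, ?_⟩ ?_) x
  · intro x y hxy
    simpa using (blockEquiv _ h).injective hxy
  · intro j
    obtain ⟨⟨i, x⟩, rfl⟩ := (blockEquiv _ h).surjective j
    obtain rfl := Subsingleton.elim i 0
    exact ⟨x, rfl⟩
  · intro x y hxy
    rcases (blockEquiv_lt_iff _ _ _ _).1 hxy with hlt | ⟨_, hlt⟩
    · exact absurd hlt (lt_irrefl _)
    · exact hlt

theorem blockEquiv_ones {n : ℕ} (h : ∑ _ : Fin n, 1 = n) (i : Fin n) :
    blockEquiv (fun _ : Fin n ↦ 1) h ⟨i, 0⟩ = i := by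
  refine congrFun (eq_of_lt_imp_lt (f := fun i ↦ blockEquiv (fun _ : Fin n ↦ 1) h ⟨i, 0⟩)
    (g := id) ⟨?_, ?_⟩ ?_) i
  · intro x y hxy
    simpa using (blockEquiv _ h).injective hxy
  · intro j
    obtain ⟨⟨i, x⟩, rfl⟩ := (blockEquiv _ h).surjective j
    obtain rfl := Subsingleton.elim x 0
    exact ⟨i, rfl⟩
  · intro x y hxy
    rcases (blockEquiv_lt_iff _ _ _ _).1 hxy with hlt | ⟨_, hlt⟩
    · exact hlt
    · exact absurd hlt (lt_irrefl _)

theorem symComp_blockEquiv {k n : ℕ} (m : Fin k → ℕ) (h : ∑ i, m i = n) (σ : Equiv.Perm (Fin k))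
    (τ : ∀ i, Equiv.Perm (Fin (m i))) (i : Fin k) (x : Fin (m i)) :
    symComp m h σ τ (blockEquiv m h ⟨i, x⟩) =
      blockEquiv (fun j ↦ m (σ.symm j)) (sum_perm h σ)
        ⟨σ i, Fin.cast (congrArg m (σ.symm_apply_apply i).symm) (τ i x)⟩ := by
  simp only [symComp, Equiv.trans_apply, Equiv.symm_apply_apply]
  rfl

/-! ### Operad identities for ordered little intervals, with permuted blocks -/

namespace LittleIntervals₀

theorem compFun_blockEquiv {k n : ℕ} (m : Fin k → ℕ) (h : ∑ i, m i = n) (a : Fin k → ℝ × ℝ)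
    (b : ∀ i, Fin (m i) → ℝ × ℝ) (i : Fin k) (x : Fin (m i)) :
    compFun m h a b (blockEquiv m h ⟨i, x⟩) =
      ((a i).1 + ((a i).2 - (a i).1) * (b i x).1, (a i).1 + ((a i).2 - (a i).1) * (b i x).2) := by
  unfold compFun
  rw [Equiv.symm_apply_apply]

theorem compFun_assoc {k N n : ℕ} (m : Fin k → ℕ) (h : ∑ i, m i = N) (l : Fin N → ℕ)
    (h₁ : ∑ j, l j = n) (h₂ : ∑ i, ∑ x, l (blockEquiv m h ⟨i, x⟩) = n) (a : Fin k → ℝ × ℝ)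
    (b : ∀ i, Fin (m i) → ℝ × ℝ) (c : ∀ j, Fin (l j) → ℝ × ℝ) :
    compFun l h₁ (compFun m h a b) c =
      compFun (fun i ↦ ∑ x, l (blockEquiv m h ⟨i, x⟩)) h₂ a
        (fun i ↦ compFun (fun x ↦ l (blockEquiv m h ⟨i, x⟩)) rfl (b i)
          (fun x ↦ c (blockEquiv m h ⟨i, x⟩))) := by
  funext j
  obtain ⟨⟨J, y⟩, rfl⟩ := (blockEquiv l h₁).surjective j
  obtain ⟨⟨i, x⟩, rfl⟩ := (blockEquiv m h).surjective J
  rw [compFun_blockEquiv, compFun_blockEquiv, blockEquiv_blockEquiv m h l h₁ h₂,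
    compFun_blockEquiv, compFun_blockEquiv]
  ext <;> ring

/-- Reindexing by the block permutation undoes the permutation of the blocks and applies each `τ i`
inside its block. This lets permuted composites be compared without transporting along equalities of
arities. -/
theorem compFun_symComp {k n : ℕ} (m : Fin k → ℕ) (h : ∑ i, m i = n) (σ : Equiv.Perm (Fin k))
    (τ : ∀ i, Equiv.Perm (Fin (m i))) (a : Fin k → ℝ × ℝ) (b : ∀ i, Fin (m i) → ℝ × ℝ) :
    compFun (fun j ↦ m (σ.symm j)) (sum_perm h σ) a (fun j ↦ b (σ.symm j)) ∘ symComp m h σ τ =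
      compFun m h (a ∘ σ) (fun i ↦ b i ∘ τ i) := by
  funext j
  obtain ⟨⟨i, x⟩, rfl⟩ := (blockEquiv m h).surjective j
  have key : ∀ (i' : Fin k) (e : i' = i) (y : Fin (m i)), b i' (Fin.cast (congrArg m e.symm) y) =
      b i y := by
    rintro i' rfl y
    rfl
  rw [Function.comp_apply, symComp_blockEquiv, compFun_blockEquiv, compFun_blockEquiv,
    key _ (σ.symm_apply_apply i)]
  rfl

theorem coe_comp {k n : ℕ} (m : Fin k → ℕ) (h : ∑ i, m i = n) (a : LittleIntervals₀ k)
    (b : ∀ i, LittleIntervals₀ (m i)) :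
    (comp m h a b).1.1 = compFun m h a.1.1 (fun i ↦ (b i).1.1) := rfl

theorem comp_assoc {k N n : ℕ} (m : Fin k → ℕ) (h : ∑ i, m i = N) (l : Fin N → ℕ)
    (h₁ : ∑ j, l j = n) (h₂ : ∑ i, ∑ x, l (blockEquiv m h ⟨i, x⟩) = n) (a : LittleIntervals₀ k)
    (b : ∀ i, LittleIntervals₀ (m i)) (c : ∀ j, LittleIntervals₀ (l j)) :
    comp l h₁ (comp m h a b) c =
      comp (fun i ↦ ∑ x, l (blockEquiv m h ⟨i, x⟩)) h₂ a
        (fun i ↦ comp (fun x ↦ l (blockEquiv m h ⟨i, x⟩)) rfl (b i)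
          (fun x ↦ c (blockEquiv m h ⟨i, x⟩))) :=
  Subtype.ext (Subtype.ext (compFun_assoc m h l h₁ h₂ a.1.1 (fun i ↦ (b i).1.1)
    (fun j ↦ (c j).1.1)))

theorem coe_std (n : ℕ) (i : Fin n) : (std n).1.1 i = ((i : ℝ) / n, ((i : ℝ) + 1) / n) := rfl

theorem std_one_comp {n : ℕ} (h : ∑ _ : Fin 1, n = n) (a : LittleIntervals₀ n) :
    comp (fun _ : Fin 1 ↦ n) h (std 1) (fun _ ↦ a) = a := by
  refine Subtype.ext (Subtype.ext (funext fun j ↦ ?_))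
  conv_lhs => rw [← blockEquiv_one h j]
  rw [coe_comp, compFun_blockEquiv, coe_std]
  ext <;> simp

theorem comp_std_one {n : ℕ} (h : ∑ _ : Fin n, 1 = n) (a : LittleIntervals₀ n) :
    comp (fun _ : Fin n ↦ 1) h a (fun _ ↦ std 1) = a := by
  refine Subtype.ext (Subtype.ext (funext fun j ↦ ?_))
  conv_lhs => rw [← blockEquiv_ones h j]
  rw [coe_comp, compFun_blockEquiv, coe_std]
  ext <;> simp

/-- Two ways of composing permuted blocks of little intervals agree. -/
theorem comp_assoc_of_symComp_eq {k N n : ℕ} (m : Fin k → ℕ) (h : ∑ i, m i = N) (l : Fin N → ℕ)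
    (h₁ : ∑ j, l j = n) (h₂ : ∑ i, ∑ x, l (blockEquiv m h ⟨i, x⟩) = n) (σ : Equiv.Perm (Fin k))
    (τ : ∀ i, Equiv.Perm (Fin (m i))) (υ : ∀ j, Equiv.Perm (Fin (l j)))
    (ρ : Equiv.Perm (Fin N)) (hρ : ρ = symComp m h σ τ)
    (hσ : symComp l h₁ ρ υ = symComp (fun i ↦ ∑ x, l (blockEquiv m h ⟨i, x⟩)) h₂ σ
      (fun i ↦ symComp (fun x ↦ l (blockEquiv m h ⟨i, x⟩)) rfl (τ i)
        (fun x ↦ υ (blockEquiv m h ⟨i, x⟩))))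
    (a : LittleIntervals₀ k) (b : ∀ i, LittleIntervals₀ (m i)) (c : ∀ j, LittleIntervals₀ (l j)) :
    comp (fun j ↦ l (ρ.symm j)) (sum_perm h₁ ρ)
        (comp (fun i ↦ m (σ.symm i)) (sum_perm h σ) a (fun i ↦ b (σ.symm i)))
        (fun j ↦ c (ρ.symm j)) =
      comp (fun i ↦ ∑ x, l (blockEquiv m h ⟨σ.symm i, x⟩)) (sum_perm h₂ σ) a
        (fun i ↦ comp (fun x ↦ l (blockEquiv m h ⟨σ.symm i, (τ (σ.symm i)).symm x⟩))
          (sum_perm (m := fun x ↦ l (blockEquiv m h ⟨σ.symm i, x⟩)) rfl (τ (σ.symm i)))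
          (b (σ.symm i)) (fun x ↦ c (blockEquiv m h ⟨σ.symm i, (τ (σ.symm i)).symm x⟩))) := by
  refine Subtype.ext (Subtype.ext ?_)
  -- After precomposition with the total block permutation, the permutations only reindex the
  -- inputs, and plain associativity applies.
  refine (symComp l h₁ ρ υ).surjective.injective_comp_right ?_
  refine (compFun_symComp l h₁ ρ υ _ (fun j ↦ (c j).1.1)).trans ?_
  have h₃ := compFun_symComp m h σ τ a.1.1 (fun i ↦ (b i).1.1)
  rw [← hρ] at h₃
  refine (congrArg (fun f ↦ compFun l h₁ f _) h₃).trans ?_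
  rw [hσ]
  refine (compFun_assoc m h l h₁ h₂ _ _ _).trans (Eq.symm ?_)
  refine (compFun_symComp (fun i ↦ ∑ x, l (blockEquiv m h ⟨i, x⟩)) h₂ σ
    (fun i ↦ symComp (fun x ↦ l (blockEquiv m h ⟨i, x⟩)) rfl (τ i)
        (fun x ↦ υ (blockEquiv m h ⟨i, x⟩))) a.1.1
    (fun i ↦ compFun (fun x ↦ l (blockEquiv m h ⟨i, (τ i).symm x⟩))
      (sum_perm (m := fun x ↦ l (blockEquiv m h ⟨i, x⟩)) rfl (τ i)) (b i).1.1
      (fun x ↦ (c (blockEquiv m h ⟨i, (τ i).symm x⟩)).1.1))).trans ?_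
  congr 1
  funext i
  exact compFun_symComp (fun x ↦ l (blockEquiv m h ⟨i, x⟩)) rfl (τ i)
    (fun x ↦ υ (blockEquiv m h ⟨i, x⟩)) (b i).1.1 (fun x ↦ (c (blockEquiv m h ⟨i, x⟩)).1.1)

end LittleIntervals₀

/-! ### Linear paths of little intervals -/

namespace LittleIntervals₀

/-- Two paths with the same end points are homotopic through convex combinations. -/
theorem paths_homotopic {k : ℕ} {a b : LittleIntervals₀ k} (γ γ' : Path a b) :
    γ.Homotopic γ' := by
  refine ⟨{ toFun := fun z ↦ ofOrdered (LittleIntervals.ordered_combo (γ z.2).ordered (γ' z.2).ordered z.1)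
            continuous_toFun := ?_
            map_zero_left := fun s ↦ ?_
            map_one_left := fun s ↦ ?_
            prop' := ?_ }⟩
  · refine Continuous.subtype_mk (Continuous.subtype_mk ?_ _) _
    have h1 : Continuous fun z : unitInterval × unitInterval ↦ (γ z.2).1.1 :=
      continuous_subtype_val.comp (continuous_subtype_val.comp (γ.continuous.comp continuous_snd))
    have h2 : Continuous fun z : unitInterval × unitInterval ↦ (γ' z.2).1.1 :=
      continuous_subtype_val.comp (continuous_subtype_val.comp (γ'.continuous.comp continuous_snd))
    fun_prop
  · exact Subtype.ext (Subtype.ext (by simp [ofOrdered, LittleIntervals.ofOrdered]))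
  · exact Subtype.ext (Subtype.ext (by simp [ofOrdered, LittleIntervals.ofOrdered]))
  · rintro t s (rfl | rfl) <;>
      exact Subtype.ext (Subtype.ext (by
        simp [ofOrdered, LittleIntervals.ofOrdered, ← add_smul]))

theorem continuous_comp {k n : ℕ} (m : Fin k → ℕ) (h : ∑ i, m i = n) :
    Continuous fun p : LittleIntervals₀ k × (∀ i, LittleIntervals₀ (m i)) ↦ comp m h p.1 p.2 := by
  refine Continuous.subtype_mk (Continuous.subtype_mk (continuous_pi fun j ↦ ?_) _) _
  unfold compFun
  generalize (blockEquiv m h).symm j = p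
  dsimp only
  have h1 : Continuous fun q : LittleIntervals₀ k × (∀ i, LittleIntervals₀ (m i)) ↦
      q.1.1.1 p.1 := (continuous_apply p.1).comp (continuous_subtype_val.comp
        (continuous_subtype_val.comp continuous_fst))
  have h2 : Continuous fun q : LittleIntervals₀ k × (∀ i, LittleIntervals₀ (m i)) ↦
      (q.2 p.1).1.1 p.2 := (continuous_apply p.2).comp (continuous_subtype_val.comp
        (continuous_subtype_val.comp ((continuous_apply p.1).comp continuous_snd)))
  fun_prop

end LittleIntervals₀

/-! ### Uniqueness of lifted paths and the lifting of the good basepoint -/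

namespace UnivCover

variable {X : Type*} [TopologicalSpace X] {e : X}

theorem mk_congr {x y : X} {δ : Path e x} {δ' : Path e y} (h : ∀ t, δ t = δ' t) :
    mk δ = mk δ' := by
  rw [mk_eq_extend_base, mk_eq_extend_base]
  exact extend_congr (base e) h

theorem mk_homotopic {x : X} {δ δ' : Path e x} (h : δ.Homotopic δ') : mk δ = mk δ' :=
  congrArg (Sigma.mk x) (Path.Homotopic.Quotient.eq.2 h)

/-- The end point of the lifting of a path. -/
theorem eq_mk_trans_of_path (hp : IsCoveringMap (proj : UnivCover X e → X)) {a b : UnivCover X e}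
    (Γ : Path a b) {x y : X} {δ₀ : Path e x} {δ : Path x y} (ha : a = mk δ₀)
    (h : ∀ t, (Γ t).proj = δ t) : b = mk (δ₀.trans δ) := by
  subst ha
  rw [← extend_eq_of_continuous hp Γ]
  exact extend_congr (mk δ₀) (δ' := δ) h

/-- The working form of unique lifting: identities in the cover are carried along paths from the
basepoints. -/
theorem eq_of_path (hp : IsCoveringMap (proj : UnivCover X e → X)) {a b a' b' : UnivCover X e}
    (Γ : Path a b) (Γ' : Path a' b') (ha : a = a') (h : ∀ t, (Γ t).proj = (Γ' t).proj) :
    b = b' := by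
  have := hp.eq_of_comp_eq Γ.continuous Γ'.continuous (funext h) 0 (by simpa using ha)
  simpa using congrFun this 1

theorem subsingleton_of_subsingleton [Subsingleton X] : Subsingleton (UnivCover X e) := by
  refine ⟨fun a b ↦ ?_⟩
  obtain ⟨α, hα⟩ := exists_extend_base a
  obtain ⟨β, hβ⟩ := exists_extend_base b
  rw [hα, hβ]
  exact mk_congr fun t ↦ Subsingleton.elim _ _

end UnivCover

namespace GoodBasepoint

variable {X : ℕ → Type*} [∀ n, TopologicalSpace (X n)] {C : TopOperad X}

/-- The lifting of `η` to the universal covers. -/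
noncomputable def lift (η : GoodBasepoint C) {n : ℕ} (c : LittleIntervals₀ n) :
    UnivCover (X n) (η.pt n) :=
  .mk ((LittleIntervals₀.linearPath (LittleIntervals₀.std n) c).map (η.continuous n))

/-- Any path of configurations may replace the linear one, by convexity. All coherence between
linear paths comes from this. -/
theorem mk_map_eq_lift (η : GoodBasepoint C) {n : ℕ} {c : LittleIntervals₀ n}
    (γ : Path (LittleIntervals₀.std n) c) :
    UnivCover.mk (e := η.pt n) (γ.map (η.continuous n)) = η.lift c :=
  UnivCover.mk_homotopic ((LittleIntervals₀.paths_homotopic γ _).map ⟨_, η.continuous n⟩)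

theorem lift_std (η : GoodBasepoint C) (n : ℕ) :
    η.lift (LittleIntervals₀.std n) = .base (η.pt n) :=
  (η.mk_map_eq_lift (Path.refl _)).symm

end GoodBasepoint

/-! ### Liftings of the composition -/

namespace GOperad

variable {G : ℕ → Type*} [∀ n, Group (G n)] {𝒢 : GroupOperad G} {X : ℕ → Type*}
  [∀ n, TopologicalSpace (X n)] [∀ n, MulAction (G n) (X n)]
  [∀ n, ContinuousConstSMul (G n) (X n)] {C : GOperad 𝒢 X} {η : GoodBasepoint C.toTopOperad}

namespace IsLift

variable {k n : ℕ} {m : Fin k → ℕ} {h : ∑ i, m i = n}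
  {f f' : UnivCover (X k) (η.pt k) → (∀ i, UnivCover (X (m i)) (η.pt (m i))) →
      UnivCover (X n) (η.pt n)}

/-- The image of a tuple of paths under a lifting of the composition. -/
noncomputable def path (hf : C.IsLift η m h f) {a a' : UnivCover (X k) (η.pt k)}
    {b b' : ∀ i, UnivCover (X (m i)) (η.pt (m i))} (α : Path a a') (β : ∀ i, Path (b i) (b' i)) :
    Path (f a b) (f a' b') where
  toFun t := f (α t) (fun i ↦ β i t)
  continuous_toFun := hf.continuous.comp_path (g := fun t ↦ (α t, fun i ↦ β i t))
    (α.continuous.prodMk (continuous_pi fun i ↦ (β i).continuous))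
  source' := by simp
  target' := by simp

theorem path_apply (hf : C.IsLift η m h f) {a a' : UnivCover (X k) (η.pt k)}
    {b b' : ∀ i, UnivCover (X (m i)) (η.pt (m i))} (α : Path a a') (β : ∀ i, Path (b i) (b' i))
    (t : unitInterval) : hf.path α β t = f (α t) (fun i ↦ β i t) := rfl

theorem unique (hp : IsCoveringMap (UnivCover.proj : UnivCover (X n) (η.pt n) → X n))
    (hf : C.IsLift η m h f) (hf' : C.IsLift η m h f') : f = f' := by
  funext a b
  let α := PathConnectedSpace.somePath (UnivCover.base (η.pt k)) a
  let β := fun i ↦ PathConnectedSpace.somePath (UnivCover.base (η.pt (m i))) (b i)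
  refine UnivCover.eq_of_path hp (hf.path α β) (hf'.path α β) (hf.base.trans hf'.base.symm)
    fun t ↦ ?_
  rw [path_apply, path_apply, hf.proj, hf'.proj]

/-- Apply the lifting to the canonical lifts of `α` and `β`. The result starts at the class of the
linear path and lies over `γ(α; β₁, …)`, which determines its end point. -/
theorem apply_mk (hp : IsCoveringMap (UnivCover.proj : UnivCover (X n) (η.pt n) → X n))
    (hf : C.IsLift η m h f) {x : X k} {y : ∀ i, X (m i)} (α : Path (η.pt k) x)
    (β : ∀ i, Path (η.pt (m i)) (y i)) :
    f (.mk α) (fun i ↦ .mk (β i)) = .mk ((η.linear m h).trans (C.compPath m h α β)) := by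
  have := UnivCover.eq_mk_trans_of_path hp
    (hf.path ((UnivCover.base (η.pt k)).liftPath α)
      fun i ↦ (UnivCover.base (η.pt (m i))).liftPath (β i))
    (δ := C.compPath m h α β) hf.base fun t ↦ hf.proj _ _
  rw [← this]
  congr 1
  · exact UnivCover.mk_eq_extend_base α
  · exact funext fun i ↦ UnivCover.mk_eq_extend_base (β i)

/-- By the path formula both sides are images under `η` of paths from `c_n` to the same
configuration. So `η.lift` respects composition, and basepoint identities can be checked on
intervals. -/
theorem apply_lift (hp : IsCoveringMap (UnivCover.proj : UnivCover (X n) (η.pt n) → X n))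
    (hf : C.IsLift η m h f) (a : LittleIntervals₀ k) (b : ∀ i, LittleIntervals₀ (m i)) :
    f (η.lift a) (fun i ↦ η.lift (b i)) = η.lift (LittleIntervals₀.comp m h a b) := by
  let γ : Path (LittleIntervals₀.comp m h (.std k) (fun i ↦ .std (m i)))
      (LittleIntervals₀.comp m h a b) :=
    { toFun := fun t ↦ LittleIntervals₀.comp m h (LittleIntervals₀.linearPath (.std k) a t)
        (fun i ↦ LittleIntervals₀.linearPath (.std (m i)) (b i) t)
      continuous_toFun := (LittleIntervals₀.continuous_comp m h).comp
        ((Path.continuous _).prodMk (continuous_pi fun i ↦ Path.continuous _))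
      source' := by simp
      target' := by simp }
  rw [← η.mk_map_eq_lift ((LittleIntervals₀.linearPath _ _).trans γ)]
  refine (hf.apply_mk hp _ _).trans (UnivCover.mk_congr fun t ↦ ?_)
  change _ = η.η n (((LittleIntervals₀.linearPath _ _).trans γ) t)
  simp only [Path.trans_apply]
  split_ifs
  · rfl
  · exact (η.map_comp m h _ _).symm

end IsLift

/-- Lifting criterion for coverings, on the compactly generated refinement of the product. Covers
inherit the needed local properties from their bases. -/
theorem exists_isLift (hp : ∀ n, IsCoveringMap (UnivCover.proj : UnivCover (X n) (η.pt n) → X n))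
    (hloc : ∀ n, LocallyPathConnectedSpace (X n)) {k n : ℕ} (m : Fin k → ℕ) (h : ∑ i, m i = n) :
    ∃ f, C.IsLift η m h f := by
  have := C.t2
  have := C.compactlyGenerated
  have := fun n ↦ (hp n).t2Space
  have := fun n ↦ (hp n).isLocalHomeomorph.compactlyCoherentSpace
  have := fun n ↦ (hp n).isLocalHomeomorph.locallyPathConnectedSpace
  have := fun n ↦ UnivCover.simplyConnectedSpace (hp n)
  let E := UnivCover (X k) (η.pt k) × (∀ i, UnivCover (X (m i)) (η.pt (m i)))
  have : LocallyPathConnectedSpace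
      (CompactCoherentification (∀ i, UnivCover (X (m i)) (η.pt (m i)))) :=
    locallyPathConnectedSpace_compactCoherentification_pi
  have : LocallyPathConnectedSpace (CompactCoherentification E) :=
    locallyPathConnectedSpace_compactCoherentification_prod
  have : SimplyConnectedSpace (CompactCoherentification E) :=
    simplyConnectedSpace_compactCoherentification
  let P : E → X k × (∀ i, X (m i)) := fun z ↦ (z.1.proj, fun i ↦ (z.2 i).proj)
  have hP : Continuous P := (UnivCover.continuous_proj.comp continuous_fst).prodMk
    (continuous_pi fun i ↦ UnivCover.continuous_proj.comp
      ((continuous_apply i).comp continuous_snd))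
  obtain ⟨F, ⟨hF, hF'⟩, -⟩ := (hp n).existsUnique_continuousMap_lifts
    (A := CompactCoherentification E) ⟨_, (C.continuous_comp m h).comp_continuous hP⟩
    (CompactCoherentification.mk E (.base _, fun _ ↦ .base _)) (.mk (η.linear m h)) rfl
  exact ⟨fun a b ↦ F (CompactCoherentification.mk E (a, b)), F.continuous,
    fun a b ↦ congrFun hF' (CompactCoherentification.mk E (a, b)), hF⟩

end GOperad

/-! ### Operad axioms upstairs and the composition of the fundamental groups -/

namespace GOperad

variable {G : ℕ → Type*} [∀ n, Group (G n)] {𝒢 : GroupOperad G} {X : ℕ → Type*}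
  [∀ n, TopologicalSpace (X n)] [∀ n, MulAction (G n) (X n)]
  [∀ n, ContinuousConstSMul (G n) (X n)] {C : GOperad 𝒢 X} {η : GoodBasepoint C.toTopOperad}
  {F : ∀ {k n : ℕ} (m : Fin k → ℕ) (_ : ∑ i, m i = n), UnivCover (X k) (η.pt k) →
    (∀ i, UnivCover (X (m i)) (η.pt (m i))) → UnivCover (X n) (η.pt n)}

theorem lift_assoc (hp : ∀ n, IsCoveringMap (UnivCover.proj : UnivCover (X n) (η.pt n) → X n))
    (hF : ∀ {k n : ℕ} (m : Fin k → ℕ) (h : ∑ i, m i = n), C.IsLift η m h (F m h))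
    {k N n : ℕ} (m : Fin k → ℕ) (h : ∑ i, m i = N) (l : Fin N → ℕ) (h₁ : ∑ j, l j = n)
    (h₂ : ∑ i, ∑ x, l (blockEquiv m h ⟨i, x⟩) = n) (a : UnivCover (X k) (η.pt k))
    (b : ∀ i, UnivCover (X (m i)) (η.pt (m i))) (c : ∀ j, UnivCover (X (l j)) (η.pt (l j))) :
    F l h₁ (F m h a b) c =
      F (fun i ↦ ∑ x, l (blockEquiv m h ⟨i, x⟩)) h₂ a
        (fun i ↦ F (fun x ↦ l (blockEquiv m h ⟨i, x⟩)) rfl (b i)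
          (fun x ↦ c (blockEquiv m h ⟨i, x⟩))) := by
  let α := PathConnectedSpace.somePath (UnivCover.base (η.pt k)) a
  let β := fun i ↦ PathConnectedSpace.somePath (UnivCover.base (η.pt (m i))) (b i)
  let δ := fun j ↦ PathConnectedSpace.somePath (UnivCover.base (η.pt (l j))) (c j)
  refine UnivCover.eq_of_path (hp n) ((hF l h₁).path ((hF m h).path α β) δ)
    ((hF _ h₂).path α fun i ↦ (hF _ rfl).path (β i) fun x ↦ δ (blockEquiv m h ⟨i, x⟩)) ?_
    fun t ↦ ?_
  -- The starting points are lifts of composites of the `c_k`, so associativity of little intervals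
  -- identifies them.
  · simp only [← η.lift_std, (hF _ _).apply_lift (hp _)]
    rw [LittleIntervals₀.comp_assoc m h l h₁ h₂]
  · simp only [IsLift.path_apply, (hF _ _).proj]
    exact C.assoc m h l h₁ h₂ _ _ _

theorem lift_one_comp
    (hp : ∀ n, IsCoveringMap (UnivCover.proj : UnivCover (X n) (η.pt n) → X n))
    (hF : ∀ {k n : ℕ} (m : Fin k → ℕ) (h : ∑ i, m i = n), C.IsLift η m h (F m h))
    {n : ℕ} (a : UnivCover (X n) (η.pt n)) :
    F (fun _ : Fin 1 ↦ n) (by simp) (.base (η.pt 1)) (fun _ ↦ a) = a := by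
  let α := PathConnectedSpace.somePath (UnivCover.base (η.pt n)) a
  refine UnivCover.eq_of_path (hp n) ((hF (fun _ : Fin 1 ↦ n) (by simp)).path
    (Path.refl (UnivCover.base (η.pt 1))) fun _ ↦ α) α ?_ fun t ↦ ?_
  · simp only [← η.lift_std, (hF _ _).apply_lift (hp _), LittleIntervals₀.std_one_comp]
  · simp only [IsLift.path_apply, (hF _ _).proj]
    -- The basepoint in arity one lies over the unit of `C`, because `η` preserves units.
    refine (congrArg (fun x ↦ C.comp _ _ x _) ?_).trans (C.one_comp _)
    exact η.map_one

theorem lift_comp_one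
    (hp : ∀ n, IsCoveringMap (UnivCover.proj : UnivCover (X n) (η.pt n) → X n))
    (hF : ∀ {k n : ℕ} (m : Fin k → ℕ) (h : ∑ i, m i = n), C.IsLift η m h (F m h))
    {n : ℕ} (a : UnivCover (X n) (η.pt n)) :
    F (fun _ : Fin n ↦ 1) (by simp) a (fun _ ↦ .base (η.pt 1)) = a := by
  let α := PathConnectedSpace.somePath (UnivCover.base (η.pt n)) a
  refine UnivCover.eq_of_path (hp n) ((hF (fun _ : Fin n ↦ 1) (by simp)).path α
    fun _ ↦ Path.refl (UnivCover.base (η.pt 1))) α ?_ fun t ↦ ?_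
  · simp only [← η.lift_std, (hF _ _).apply_lift (hp _), LittleIntervals₀.comp_std_one]
  · simp only [IsLift.path_apply, (hF _ _).proj]
    refine (congrArg (fun x ↦ C.comp _ _ _ x) (funext fun _ ↦ ?_)).trans (C.comp_one _)
    exact η.map_one

/-- Equivariance in `C` says that the two lifted composites of basepoints lie over points related by
the composite group element, so a lifted translation joins them. -/
theorem exists_pi1Comp (hF : ∀ {k n : ℕ} (m : Fin k → ℕ) (h : ∑ i, m i = n),
      C.IsLift η m h (F m h)) {k n : ℕ} (m : Fin k → ℕ) (h : ∑ i, m i = n)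
    (s : OrbitPi1 (G k) (X k) (η.pt k)) (t : ∀ i, OrbitPi1 (G (m i)) (X (m i)) (η.pt (m i))) :
    ∃ p : OrbitPi1 (G n) (X n) (η.pt n),
      p.toGroup = 𝒢.comp m h s.toGroup (fun i ↦ (t i).toGroup) ∧
      p • F (fun i ↦ m ((𝒢.perm s.toGroup).symm i)) (sum_perm h (𝒢.perm s.toGroup))
          (.base _) (fun _ ↦ .base _) =
        F m h (s • .base _) (fun i ↦ t i • .base _) := by
  refine OrbitPi1.exists_smul_eq _ ?_
  rw [(hF _ _).proj, (hF _ _).proj]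
  exact C.smul_comp_smul m h s.toGroup (fun i ↦ (t i).toGroup) (η.pt k) (fun i ↦ η.pt (m i))

/-- The composition of the fundamental groups operad. -/
noncomputable def pi1Comp (hF : ∀ {k n : ℕ} (m : Fin k → ℕ) (h : ∑ i, m i = n),
      C.IsLift η m h (F m h)) {k n : ℕ} (m : Fin k → ℕ) (h : ∑ i, m i = n)
    (s : OrbitPi1 (G k) (X k) (η.pt k)) (t : ∀ i, OrbitPi1 (G (m i)) (X (m i)) (η.pt (m i))) :
    OrbitPi1 (G n) (X n) (η.pt n) :=
  (exists_pi1Comp hF m h s t).choose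

section

variable (hp : ∀ n, IsCoveringMap (UnivCover.proj : UnivCover (X n) (η.pt n) → X n))
  (hF : ∀ {k n : ℕ} (m : Fin k → ℕ) (h : ∑ i, m i = n), C.IsLift η m h (F m h))
  {k n : ℕ} (m : Fin k → ℕ) (h : ∑ i, m i = n) (s : OrbitPi1 (G k) (X k) (η.pt k))
  (t : ∀ i, OrbitPi1 (G (m i)) (X (m i)) (η.pt (m i)))

theorem toGroup_pi1Comp :
    (pi1Comp hF m h s t).toGroup = 𝒢.comp m h s.toGroup (fun i ↦ (t i).toGroup) :=
  (exists_pi1Comp hF m h s t).choose_spec.1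

theorem pi1Comp_smul_base :
    pi1Comp hF m h s t • F (fun i ↦ m ((𝒢.perm s.toGroup).symm i))
        (sum_perm h (𝒢.perm s.toGroup)) (.base _) (fun _ ↦ .base _) =
      F m h (s • .base _) (fun i ↦ t i • .base _) :=
  (exists_pi1Comp hF m h s t).choose_spec.2

-- The defining identity at basepoints propagates along paths, as both sides project to the two
-- sides of the equivariance axiom of `C`.
include hp in
theorem lift_smul_comp_smul (a : UnivCover (X k) (η.pt k))
    (b : ∀ i, UnivCover (X (m i)) (η.pt (m i))) :
    F m h (s • a) (fun i ↦ t i • b i) =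
      pi1Comp hF m h s t • F (fun i ↦ m ((𝒢.perm s.toGroup).symm i))
        (sum_perm h (𝒢.perm s.toGroup)) a (fun i ↦ b ((𝒢.perm s.toGroup).symm i)) := by
  let α := PathConnectedSpace.somePath (UnivCover.base (η.pt k)) a
  let β := fun i ↦ PathConnectedSpace.somePath (UnivCover.base (η.pt (m i))) (b i)
  refine UnivCover.eq_of_path (hp n)
    ((hF m h).path (α.map (continuous_const_smul s))
      fun i ↦ (β i).map (continuous_const_smul (t i)))
    (((hF _ (sum_perm h (𝒢.perm s.toGroup))).path α
      fun i ↦ β ((𝒢.perm s.toGroup).symm i)).map (continuous_const_smul (pi1Comp hF m h s t)))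
    (pi1Comp_smul_base hF m h s t).symm fun r ↦ ?_
  change (F m h (s • α r) fun i ↦ t i • β i r).proj =
    (pi1Comp hF m h s t • F _ _ (α r) fun i ↦ β ((𝒢.perm s.toGroup).symm i) r).proj
  simp only [(hF _ _).proj, OrbitPi1.proj_smul, toGroup_pi1Comp]
  exact C.smul_comp_smul m h s.toGroup (fun i ↦ (t i).toGroup) _ _

-- A composite in the groups is recognised by its image in `G n` and its effect at a single point,
-- which may be chosen conveniently.
include hp in
theorem eq_pi1Comp_of_smul_eq {p : OrbitPi1 (G n) (X n) (η.pt n)}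
    (hpG : p.toGroup = 𝒢.comp m h s.toGroup (fun i ↦ (t i).toGroup))
    (a : UnivCover (X k) (η.pt k)) (b : ∀ i, UnivCover (X (m i)) (η.pt (m i)))
    (hps : p • F (fun i ↦ m ((𝒢.perm s.toGroup).symm i)) (sum_perm h (𝒢.perm s.toGroup)) a
      (fun i ↦ b ((𝒢.perm s.toGroup).symm i)) = F m h (s • a) (fun i ↦ t i • b i)) :
    p = pi1Comp hF m h s t :=
  OrbitPi1.eq_of_smul_eq (hpG.trans (toGroup_pi1Comp hF m h s t).symm)
    (hps.trans (lift_smul_comp_smul hp hF m h s t a b))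

end

theorem pi1Comp_assoc
    (hp : ∀ n, IsCoveringMap (UnivCover.proj : UnivCover (X n) (η.pt n) → X n))
    (hF : ∀ {k n : ℕ} (m : Fin k → ℕ) (h : ∑ i, m i = n), C.IsLift η m h (F m h))
    {k N n : ℕ} (m : Fin k → ℕ) (h : ∑ i, m i = N) (l : Fin N → ℕ) (h₁ : ∑ j, l j = n)
    (h₂ : ∑ i, ∑ x, l (blockEquiv m h ⟨i, x⟩) = n) (s : OrbitPi1 (G k) (X k) (η.pt k))
    (t : ∀ i, OrbitPi1 (G (m i)) (X (m i)) (η.pt (m i)))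
    (u : ∀ j, OrbitPi1 (G (l j)) (X (l j)) (η.pt (l j))) :
    pi1Comp hF l h₁ (pi1Comp hF m h s t) u =
      pi1Comp hF (fun i ↦ ∑ x, l (blockEquiv m h ⟨i, x⟩)) h₂ s
        (fun i ↦ pi1Comp hF (fun x ↦ l (blockEquiv m h ⟨i, x⟩)) rfl (t i)
          (fun x ↦ u (blockEquiv m h ⟨i, x⟩))) := by
  have hG : (pi1Comp hF l h₁ (pi1Comp hF m h s t) u).toGroup =
      (pi1Comp hF (fun i ↦ ∑ x, l (blockEquiv m h ⟨i, x⟩)) h₂ s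
        (fun i ↦ pi1Comp hF (fun x ↦ l (blockEquiv m h ⟨i, x⟩)) rfl (t i)
          (fun x ↦ u (blockEquiv m h ⟨i, x⟩)))).toGroup := by
    simp only [toGroup_pi1Comp]
    exact 𝒢.assoc m h l h₁ h₂ _ _ _
  -- The test point has composites of basepoints with permuted blocks as its inner entries: these
  -- are exactly the points on which the inner group composites are defined.
  refine eq_pi1Comp_of_smul_eq hp hF _ _ _ _ (hG.trans (toGroup_pi1Comp ..)) (.base _)
    (fun i ↦ F (fun x ↦ l (blockEquiv m h ⟨i, (𝒢.perm (t i).toGroup).symm x⟩))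
      (sum_perm (m := fun x ↦ l (blockEquiv m h ⟨i, x⟩)) rfl (𝒢.perm (t i).toGroup))
      (.base _) (fun _ ↦ .base _)) ?_
  simp only [pi1Comp_smul_base]
  refine Eq.trans ?_ (lift_assoc hp hF m h l h₁ h₂ (s • .base _) (fun i ↦ t i • .base _)
    (fun j ↦ u j • .base _))
  rw [← pi1Comp_smul_base hF m h s t,
    lift_smul_comp_smul hp hF l h₁ (pi1Comp hF m h s t) u]
  congr 1
  -- Only composites of basepoints with differently permuted blocks remain to be compared, and these
  -- are lifts from little intervals.
  simp only [← η.lift_std, (hF _ _).apply_lift (hp _)]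
  congr 1
  refine (LittleIntervals₀.comp_assoc_of_symComp_eq m h l h₁ h₂ (𝒢.perm s.toGroup)
    (fun i ↦ 𝒢.perm (t i).toGroup) (fun j ↦ 𝒢.perm (u j).toGroup) _ ?_ ?_ (.std k)
    (fun i ↦ .std (m i)) (fun j ↦ .std (l j))).symm
  · rw [toGroup_pi1Comp, 𝒢.perm_comp]
  -- The required associativity of block permutations is the image under `perm` of associativity in
  -- `𝒢`.
  · have := congrArg 𝒢.perm hG
    simpa only [toGroup_pi1Comp, 𝒢.perm_comp] using this

end GOperad

/-- The reversed translate of `δ'` cancels against the translate of `δ'`. This accounts for the last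
leg of `pi1Path`. -/
theorem OrbitPi1.mk_trans_smul_mk {G X : Type*} [TopologicalSpace X] [Group G] [MulAction G X]
    [ContinuousConstSMul G X] {e x y : X} (g : G) (δ : Path e x) (hx : g • y = x)
    (δ' : Path e y) :
    mk g ((δ.cast rfl hx).trans (δ'.symm.map (continuous_const_smul g))) • UnivCover.mk δ' =
      UnivCover.mk δ := by
  subst hx
  refine congrArg (Sigma.mk _) ?_
  change ((Path.Homotopic.Quotient.mk δ).trans ((Path.Homotopic.Quotient.mk δ').translate g).symm
    ).trans ((Path.Homotopic.Quotient.mk δ').translate g) = Path.Homotopic.Quotient.mk δ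
  simp

/-! ### Assembly of the group operad, the universal cover and the transported structure -/

namespace GOperad

variable {G : ℕ → Type*} [∀ n, Group (G n)] {𝒢 : GroupOperad G} {X : ℕ → Type*}
  [∀ n, TopologicalSpace (X n)] [∀ n, MulAction (G n) (X n)]
  [∀ n, ContinuousConstSMul (G n) (X n)] {C : GOperad 𝒢 X}

section

variable {η : GoodBasepoint C.toTopOperad}
  {F : ∀ {k n : ℕ} (m : Fin k → ℕ) (_ : ∑ i, m i = n), UnivCover (X k) (η.pt k) →
    (∀ i, UnivCover (X (m i)) (η.pt (m i))) → UnivCover (X n) (η.pt n)}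
  (hp : ∀ n, IsCoveringMap (UnivCover.proj : UnivCover (X n) (η.pt n) → X n))
  (hF : ∀ {k n : ℕ} (m : Fin k → ℕ) (h : ∑ i, m i = n), C.IsLift η m h (F m h))

theorem subsingleton_univCover_zero (C : GOperad 𝒢 X) (e : X 0) :
    Subsingleton (UnivCover (X 0) e) := by
  obtain ⟨_⟩ := C.unique_zero
  exact UnivCover.subsingleton_of_subsingleton

/-- The fundamental groups operad. -/
noncomputable def pi1Operad : GroupOperad fun n ↦ OrbitPi1 (G n) (X n) (η.pt n) where
  one := 1
  comp := pi1Comp hF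
  unique_zero := by
    obtain ⟨_⟩ := 𝒢.unique_zero
    have := C.subsingleton_univCover_zero (η.pt 0)
    exact ⟨⟨⟨1⟩, fun p ↦ OrbitPi1.eq_of_smul_eq (z := .base _) (Subsingleton.elim _ _)
      (Subsingleton.elim _ _)⟩⟩
  assoc := pi1Comp_assoc hp hF
  one_comp a := by
    refine (eq_pi1Comp_of_smul_eq hp hF _ _ _ _ ?_ (.base _) (fun _ ↦ .base _) ?_).symm
    · rw [map_one, ← 𝒢.one_eq, 𝒢.one_comp]
    · rw [one_smul (OrbitPi1 (G 1) (X 1) (η.pt 1))]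
      exact (congrArg (a • ·) (lift_one_comp hp hF (.base _))).trans
        (lift_one_comp hp hF (a • .base _)).symm
  comp_one a := by
    refine (eq_pi1Comp_of_smul_eq hp hF _ _ _ _ ?_ (.base _) (fun _ ↦ .base _) ?_).symm
    · simp only [map_one, ← 𝒢.one_eq, 𝒢.comp_one]
    · simp only [one_smul]
      exact (congrArg (a • ·) (lift_comp_one hp hF (.base _))).trans
        (lift_comp_one hp hF (a • .base _)).symm
  perm p := 𝒢.perm p.toGroup
  perm_mul p q := by rw [map_mul, 𝒢.perm_mul]
  perm_comp m h p q := by rw [toGroup_pi1Comp, 𝒢.perm_comp]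
  one_eq := rfl
  comp_mul {k n} m h s s' t t' := by
    refine (eq_pi1Comp_of_smul_eq hp hF _ _ _ _ ?_ (.base _) (fun _ ↦ .base _) ?_).symm
    · simp only [map_mul, toGroup_pi1Comp, 𝒢.comp_mul]
    · simp only [mul_smul]
      rw [lift_smul_comp_smul hp hF m h s t, ← pi1Comp_smul_base hF _ _ s']
      congr 2
      -- The families of arities permuted by the product and by its two factors in turn are equal
      -- only by `perm_mul`, so the base composites are compared along that equality.
      have key : ∀ {m₁ m₂ : Fin k → ℕ} (h₁ : ∑ i, m₁ i = n) (h₂ : ∑ i, m₂ i = n), m₁ = m₂ →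
          F m₁ h₁ (.base _) (fun _ ↦ .base _) = F m₂ h₂ (.base _) (fun _ ↦ .base _) := by
        rintro m₁ _ h₁ h₂ rfl
        rfl
      refine key _ _ ?_
      rw [map_mul, 𝒢.perm_mul]
      rfl

/-- The operad of universal covers. -/
noncomputable def univCoverOperad :
    GOperad (pi1Operad hp hF) fun n ↦ UnivCover (X n) (η.pt n) where
  one := .base _
  comp := F
  unique_zero := by
    have := C.subsingleton_univCover_zero (η.pt 0)
    exact ⟨⟨⟨.base _⟩, fun _ ↦ Subsingleton.elim _ _⟩⟩
  assoc := lift_assoc hp hF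
  one_comp := lift_one_comp hp hF
  comp_one := lift_comp_one hp hF
  t2 n := by
    have := C.t2
    exact (hp n).t2Space
  compactlyGenerated n := by
    have := C.t2
    have := C.compactlyGenerated
    exact (hp n).isLocalHomeomorph.compactlyCoherentSpace
  continuous_comp m h := (hF m h).continuous
  smul_comp_smul := lift_smul_comp_smul hp hF

theorem isFundamentalGroupOperad : C.IsFundamentalGroupOperad η (pi1Operad hp hF) where
  perm _ := rfl
  comp {k n} m h s t f g := by
    refine (eq_pi1Comp_of_smul_eq hp hF m h _ _ rfl (.base _) (fun _ ↦ .base _) ?_).symm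
    simp only [OrbitPi1.mk_smul_base]
    refine Eq.trans ?_ ((hF m h).apply_mk (hp _) f g).symm
    -- It remains to see that `pi1Path` carries the class of the permuted linear path to that of the
    -- linear path followed by `γ(f; g₁, …)`.
    rw [(hF _ _).base]
    exact OrbitPi1.mk_trans_smul_mk (𝒢.comp m h s t) ((η.linear m h).trans (C.compPath m h f g))
      (C.smul_comp_smul m h s t (η.pt k) (fun i ↦ η.pt (m i))).symm
      (η.linear (fun i ↦ m ((𝒢.perm s).symm i)) (sum_perm h (𝒢.perm s)))

theorem isUnivCoverOperad : C.IsUnivCoverOperad η (univCoverOperad hp hF) where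
  one := rfl
  comp m h _ _ α β := (hF m h).apply_mk (hp _) α β

theorem isUniversalCover (hpath : ∀ n, PathConnectedSpace (X n)) :
    GOperad.IsUniversalCover (fun _ ↦ OrbitPi1.toGroup) (univCoverOperad hp hF) C
      (fun _ ↦ UnivCover.proj) where
  isHom_group := ⟨fun _ ↦ rfl, toGroup_pi1Comp hF⟩
  surjective_group _ := OrbitPi1.surjective_toGroup
  isHom :=
    { continuous := fun _ ↦ UnivCover.continuous_proj
      map_smul := OrbitPi1.proj_smul
      map_one := η.map_one
      map_comp := fun m h ↦ (hF m h).proj }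
  isCoveringMap := hp
  surjective _ := UnivCover.surjective_proj
  simplyConnected n := UnivCover.simplyConnectedSpace (hp n)

end

/-- Transport of the structure of a `𝒢`-operad along equivariant homeomorphisms. -/
def transport (C : GOperad 𝒢 X) {Y : ℕ → Type*} [∀ n, TopologicalSpace (Y n)]
    [∀ n, MulAction (G n) (Y n)] [∀ n, ContinuousConstSMul (G n) (Y n)] (e : ∀ n, Y n ≃ₜ X n)
    (he : ∀ {n : ℕ} (g : G n) (y : Y n), e n (g • y) = g • e n y) : GOperad 𝒢 Y where
  one := (e 1).symm C.one
  comp m h a b := (e _).symm (C.comp m h (e _ a) fun i ↦ e _ (b i))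
  unique_zero := C.unique_zero.map fun u ↦ @Equiv.unique _ _ u (e 0).toEquiv
  assoc m h l h₁ h₂ a b c := by simp only [Homeomorph.apply_symm_apply, C.assoc m h l h₁ h₂]
  one_comp a := by simp only [Homeomorph.apply_symm_apply, C.one_comp, Homeomorph.symm_apply_apply]
  comp_one a := by simp only [Homeomorph.apply_symm_apply, C.comp_one, Homeomorph.symm_apply_apply]
  t2 n := by
    have := C.t2 n
    exact (e n).symm.t2Space
  compactlyGenerated n := by
    have := C.t2 n
    have := C.compactlyGenerated n
    exact (e n).isLocalHomeomorph.compactlyCoherentSpace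
  continuous_comp {k n} m h := by
    refine (e n).symm.continuous.comp_kContinuous ((C.continuous_comp m h).comp_continuous
      (g := fun p : Y k × (∀ i, Y (m i)) ↦ (e k p.1, fun i ↦ e (m i) (p.2 i))) ?_)
    fun_prop
  smul_comp_smul {k n} m h σ τ a b := by
    refine (e n).injective ?_
    simp only [Homeomorph.apply_symm_apply, he, C.smul_comp_smul]

theorem transport_isIso (C : GOperad 𝒢 X) {Y : ℕ → Type*} [∀ n, TopologicalSpace (Y n)]
    [∀ n, MulAction (G n) (Y n)] [∀ n, ContinuousConstSMul (G n) (Y n)] (e : ∀ n, Y n ≃ₜ X n)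
    (he : ∀ {n : ℕ} (g : G n) (y : Y n), e n (g • y) = g • e n y) :
    (C.transport e he).IsIso C fun n ↦ e n :=
  ⟨{  continuous := fun n ↦ (e n).continuous
      map_smul := he
      map_one := (e 1).apply_symm_apply _
      map_comp := fun _ _ _ _ ↦ (e _).apply_symm_apply _ }, fun n ↦ (e n).isHomeomorph⟩

end GOperad

/-! ### The orbit operad and the main theorem -/

/-- The homeomorphism from the orbit space of the universal cover under the fundamental group. -/
noncomputable def OrbitPi1.modPi1Homeomorph {G X : Type*} [TopologicalSpace X] [Group G]
    [MulAction G X] [ContinuousConstSMul G X] {e : X}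
    (hp : IsQuotientCoveringMap (UnivCover.proj : UnivCover X e → X) (pi1 G X e)) :
    UnivCover.ModPi1 G X e ≃ₜ X :=
  IsHomeomorph.homeomorph (Quotient.lift UnivCover.proj fun _ _ h ↦
      hp.apply_eq_iff_mem_orbit.2 h)
    { continuous := hp.continuous.quotient_lift _
      isOpenMap := fun V hV ↦ by
        have := hp.isCoveringMap.isOpenMap _ (hV.preimage continuous_quotient_mk')
        refine (congrArg IsOpen (Set.ext fun x ↦ ⟨?_, ?_⟩)).mp this
        · rintro ⟨a, ha, rfl⟩
          exact ⟨Quotient.mk _ a, ha, rfl⟩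
        · rintro ⟨a, ha, rfl⟩
          induction a using Quotient.inductionOn with | h a => exact ⟨a, ha, rfl⟩
      bijective := by
        refine ⟨fun a b ↦ ?_, fun x ↦ ?_⟩
        · induction a, b using Quotient.inductionOn₂ with | h a b =>
          exact fun h ↦ Quotient.sound (hp.apply_eq_iff_mem_orbit.1 h)
        · obtain ⟨a, rfl⟩ := hp.surjective x
          exact ⟨Quotient.mk _ a, rfl⟩ }

theorem mainTheorem5 {G : ℕ → Type*} [∀ n, Group (G n)] (𝒢 : GroupOperad G)
    {X : ℕ → Type*} [∀ n, TopologicalSpace (X n)] [∀ n, MulAction (G n) (X n)]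
    [∀ n, ContinuousConstSMul (G n) (X n)] (C : GOperad 𝒢 X)
    (hpath : ∀ n, PathConnectedSpace (X n)) (hloc : ∀ n, LocallyPathConnectedSpace (X n))
    (hsemi : ∀ n, SemilocallySimplyConnected (X n)) (hcov : C.IsCovering)
    (η : GoodBasepoint C.toTopOperad) :
    -- `π₁(C(n); e_n, G_n e_n)` is the fundamental group of the orbit space `C(n)/G_n`
    (∀ n, Function.Bijective (OrbitPi1.toLoop : OrbitPi1 (G n) (X n) (η.pt n) → _) ∧
      ∀ f g : OrbitPi1 (G n) (X n) (η.pt n), (f * g).toLoop = f.toLoop.trans g.toLoop) ∧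
    -- the group operad `P = π₁(C/𝒢)` and the `P`-operad `U` of universal covers
    ∃ (P : GroupOperad fun n ↦ OrbitPi1 (G n) (X n) (η.pt n))
      (U : GOperad P fun n ↦ UnivCover (X n) (η.pt n)),
      C.IsFundamentalGroupOperad η P ∧ C.IsUnivCoverOperad η U ∧
      -- the composition of `U` is the unique lifting of the composition of `C`
      (∀ {k n : ℕ} (m : Fin k → ℕ) (h : ∑ i, m i = n) f, C.IsLift η m h f ↔ f = U.comp m h) ∧
      -- `U` is a covering `P`-operad and a universal cover of `C`
      U.IsCovering ∧
      GOperad.IsUniversalCover (fun _ ↦ OrbitPi1.toGroup) U C (fun _ ↦ UnivCover.proj) ∧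
      -- the quotient `𝒢`-operad `Q = U/π₁C`, and the isomorphism `Q ≅ C` induced by the projection
      ∃ (_ : ∀ n, MulAction (G n) (UnivCover.ModPi1 (G n) (X n) (η.pt n)))
        (_ : ∀ n, ContinuousConstSMul (G n) (UnivCover.ModPi1 (G n) (X n) (η.pt n)))
        (Q : GOperad 𝒢 fun n ↦ UnivCover.ModPi1 (G n) (X n) (η.pt n)),
        GOperad.IsHomAlong (fun _ ↦ OrbitPi1.toGroup) U Q (fun _ ↦ Quotient.mk _) ∧
        ∃ ψ : ∀ n, UnivCover.ModPi1 (G n) (X n) (η.pt n) → X n,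
          (∀ n (a : UnivCover (X n) (η.pt n)), ψ n (Quotient.mk _ a) = a.proj) ∧
          Q.IsIso C ψ := by
  have hq := fun n ↦ OrbitPi1.isQuotientCoveringMap_proj (G n) (X n) (η.pt n) (hsemi n)
  have hp := fun n ↦ (hq n).isCoveringMap
  choose F hF using fun {k n : ℕ} (m : Fin k → ℕ) (h : ∑ i, m i = n) ↦
    GOperad.exists_isLift hp hloc m h
  refine ⟨fun n ↦ ⟨OrbitPi1.bijective_toLoop (hcov n), OrbitPi1.toLoop_mul⟩,
    GOperad.pi1Operad hp hF, GOperad.univCoverOperad hp hF, GOperad.isFundamentalGroupOperad hp hF,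
    GOperad.isUnivCoverOperad hp hF, fun m h f ↦ ⟨fun hf ↦ hf.unique (hp _) (hF m h), ?_⟩,
    fun n ↦ OrbitPi1.isCoveringAction (hsemi n) (hcov n), GOperad.isUniversalCover hp hF hpath, ?_⟩
  · rintro rfl
    exact hF m h
  let e := fun n ↦ OrbitPi1.modPi1Homeomorph (hq n)
  -- The action on the orbit space is pulled back from `C(n)`, so the isomorphism with `C` is
  -- automatic. What remains is that the quotient maps respect the structure.
  let I : ∀ n, MulAction (G n) (UnivCover.ModPi1 (G n) (X n) (η.pt n)) := fun n ↦
    (e n).toEquiv.mulAction (G n)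
  have he : ∀ {n : ℕ} (g : G n) (y : UnivCover.ModPi1 (G n) (X n) (η.pt n)),
      e n (g • y) = g • e n y := fun g y ↦ (e _).apply_symm_apply _
  have he' : ∀ n (a : UnivCover (X n) (η.pt n)), e n (Quotient.mk _ a) = a.proj := fun _ _ ↦ rfl
  have J : ∀ n, ContinuousConstSMul (G n) (UnivCover.ModPi1 (G n) (X n) (η.pt n)) := fun n ↦
    ⟨fun g ↦ (e n).symm.continuous.comp ((continuous_const_smul g).comp (e n).continuous)⟩
  refine ⟨I, J, C.transport e he, ?_, fun n ↦ e n, he', C.transport_isIso e he⟩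
  -- Composed with the injective `e n`, the quotient map becomes `p`, so each compatibility is the
  -- corresponding one for `p`.
  exact
    { continuous := fun n ↦ continuous_quotient_mk'
      map_smul := fun {n} g a ↦ (e n).injective (by rw [he, he', he']; rfl)
      map_one := (e 1).injective (by
        rw [he']
        exact η.map_one.trans ((e 1).apply_symm_apply _).symm)
      map_comp := fun {k n} m h a b ↦ (e n).injective (by
        rw [he']
        exact ((hF m h).proj a b).trans ((e n).apply_symm_apply _).symm) }
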